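/- Consider the class of equations \[ u_t+a(t)uu_{xxx}+b(t)u_xu_{xx}+c(t)u^2u_x+f(t)uu_x+g(t)u_{xxxxx}+h(t)u_{xxx}+m(t)u+n(t)u_x+k(t)xu_x=0, \] where $\theta=(a,b,c,f,g,h,m,n,k)$ is a tuple of smooth functions of $t$ (the arbitrary elements) with $g(a^2+b^2+c^2)\neq0$ for all $t$. The subclass of this class with $f=h=0$ and $(a,c)\ne(0,0)$ (for all $t$) is normalized with respect to its usual equivalence group. This means that every (local) nondegenerate point transformation $\tilde t=T(t,x,u)$, $\tilde x=X(t,x,u)$, $\tilde u=U(t,x,u)$ that maps an equation of the subclass to an equation of the subclass is induced by a usual equivalence transformation, i.e., by a point transformation of the space with coordinates $(t,x,u,\theta)$ whose components for $(t,x,u)$ do not depend on the arbitrary elements and which preserves the subclass. The usual equivalence group of the subclass consists of the transformations \begin{gather*} \tilde t=\alpha(t),\quad \tilde x=\beta(t)x+\gamma(t),\quad \tilde u=\varphi(t)u,\\ \tilde a=\frac{\beta^3}{\alpha_t\varphi}a,\quad \tilde b=\frac{\beta^3}{\alpha_t\varphi}b,\quad \tilde c=\frac{\beta}{\alpha_t\varphi^2}c,\quad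 \tilde f=\frac{\beta}{\alpha_t\varphi}f,\quad \tilde g=\frac{\beta^5}{\alpha_t}g,\quad \tilde h=\frac{\beta^3}{\alpha_t}h,\\ \tilde m=\frac1{\alpha_t}\left(m-\frac{\varphi_t}{\varphi}\right),\quad \tilde n=\frac{\beta}{\alpha_t}\left(n+\left(\frac{\gamma}{\beta}\right)_t-k\frac{\gamma}{\beta}\right),\quad \tilde k=\frac1{\alpha_t}\left(k+\frac{\beta_t}{\beta}\right), \end{gather*} where $\alpha$, $\beta$, $\gamma$ and $\varphi$ run through the smooth functions of $t$ with $\alpha_t\beta\varphi\neq0$. -/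

import Mathlib

open scoped ContDiff Topology

/-- The names of the nine arbitrary elements of the class of equations
`u_t + a u u_xxx + b u_x u_xx + c u² u_x + f u u_x + g u_xxxxx + h u_xxx + m u + n u_x + k x u_x = 0`. -/
inductive Coef : Type
  | a | b | c | f | g | h | m | n | k
  deriving DecidableEq

instance instFintypeCoef : Fintype Coef where
  elems := {.a, .b, .c, .f, .g, .h, .m, .n, .k}
  complete := by intro x; cases x <;> decide

/-- The space of values of the tuple of arbitrary elements. -/
abbrev Values : Type := Coef → ℝ

/-- The space of the independent and dependent variables `(t, x, u)`. -/
abbrev Vars : Type := ℝ × ℝ × ℝ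

/-- A tuple of arbitrary elements: the coefficients as functions of `t`. -/
abbrev Elements : Type := ℝ → Values

/-- The left-hand side of the equation with arbitrary elements `θ`, evaluated on the function
`v` of `(t, x)` at the point `q = (t, x)`. It depends only on the 5-jet of `v` at `q`. -/
noncomputable def lhs (θ : Elements) (v : ℝ × ℝ → ℝ) (q : ℝ × ℝ) : ℝ :=
  let t := q.1
  let x := q.2
  let u := v (t, x)
  let u_t := deriv (fun s => v (s, x)) t
  let u_x := iteratedDeriv 1 (fun y => v (t, y)) x
  let u_xx := iteratedDeriv 2 (fun y => v (t, y)) x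
  let u_xxx := iteratedDeriv 3 (fun y => v (t, y)) x
  let u_xxxxx := iteratedDeriv 5 (fun y => v (t, y)) x
  u_t + θ t .a * u * u_xxx + θ t .b * u_x * u_xx + θ t .c * u ^ 2 * u_x + θ t .f * u * u_x
    + θ t .g * u_xxxxx + θ t .h * u_xxx + θ t .m * u + θ t .n * u_x + θ t .k * x * u_x

/-- The auxiliary inequality `g (a² + b² + c²) ≠ 0` of the whole class. -/
def classValues : Set Values :=
  {v | v .g * (v .a ^ 2 + v .b ^ 2 + v .c ^ 2) ≠ 0}

/-- The auxiliary conditions of the subclass with `f = h = 0` and `(a, c) ≠ (0, 0)`. -/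
def subclassValues : Set Values :=
  {v | v ∈ classValues ∧ v .f = 0 ∧ v .h = 0 ∧ (v .a, v .c) ≠ (0, 0)}

/-- The tuples of arbitrary elements, smooth on the set `I` of values of `t`, that satisfy on `I`
the auxiliary conditions singled out by `V`. -/
def elementsOn (V : Set Values) (I : Set ℝ) : Set Elements :=
  {θ | ContDiffOn ℝ ∞ θ I ∧ ∀ t ∈ I, θ t ∈ V}

/-- The values of `t` that occur in a set of points `(t, x, u)`. -/
def times (Ω : Set Vars) : Set ℝ := Prod.fst '' Ω

/-- The sets on which (local) point transformations are considered: domains of the space of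
`(t, x, u)` with connected sections `t = const`, for example boxes. The condition on the sections
makes functions that locally depend on `t` alone well-defined functions of `t`. -/
structure IsVarDomain (Ω : Set Vars) : Prop where
  isOpen : IsOpen Ω
  isConnected : IsConnected Ω
  sections : ∀ t : ℝ, IsPreconnected {q : ℝ × ℝ | (t, q) ∈ Ω}

/-- `Φ` is a nondegenerate point transformation
`t̃ = T(t, x, u)`, `x̃ = X(t, x, u)`, `ũ = U(t, x, u)` on `Ω`. -/
structure IsPointTransformation (Ω : Set Vars) (Φ : Vars → Vars) : Prop where
  smooth : ContDiffOn ℝ ∞ Φ Ω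
  nondegenerate : ∀ p ∈ Ω, (fderiv ℝ Φ p).det ≠ 0

/-- Near the point `q = (t, x)`, `Φ` maps the graph of the function `v` of `(t, x)`
into the graph of the function `w` of `(t̃, x̃)`. -/
def MapsGraph (Φ : Vars → Vars) (v w : ℝ × ℝ → ℝ) (q : ℝ × ℝ) : Prop :=
  ∀ᶠ r in 𝓝 q, w ((Φ (r.1, r.2, v r)).1, (Φ (r.1, r.2, v r)).2.1) = (Φ (r.1, r.2, v r)).2.2

/-- The point transformation `Φ` on `Ω` maps the equation with arbitrary elements `θ` to the
equation with arbitrary elements `θ'`, as manifolds in the jet space `J⁵`: a 5-jet over `Ω` (the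
jet of a function `v`) lies on the first manifold if and only if its image under the prolongation
of `Φ` (the jet of the transformed function `w`), where it is defined, lies on the second one. -/
def MapsEquation (Ω : Set Vars) (Φ : Vars → Vars) (θ θ' : Elements) : Prop :=
  ∀ t x u : ℝ, (t, x, u) ∈ Ω → ∀ v w : ℝ × ℝ → ℝ,
    ContDiffAt ℝ ∞ v (t, x) → v (t, x) = u →
    ContDiffAt ℝ ∞ w ((Φ (t, x, u)).1, (Φ (t, x, u)).2.1) →
    MapsGraph Φ v w (t, x) →
    (lhs θ v (t, x) = 0 ↔ lhs θ' w ((Φ (t, x, u)).1, (Φ (t, x, u)).2.1) = 0)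

/-- `(θ, θ', Φ)` is an admissible transformation (over `Ω`) in the class given by `V`. -/
structure IsAdmissible (V : Set Values) (Ω : Set Vars) (θ θ' : Elements) (Φ : Vars → Vars) :
    Prop where
  point : IsPointTransformation Ω Φ
  source : θ ∈ elementsOn V (times Ω)
  target : θ' ∈ elementsOn V (times (Φ '' Ω))
  maps : MapsEquation Ω Φ θ θ'

/-- The transformation `(t, x, u, θ) ↦ (Φ (t, x, u), Θ (t, x, u) θ)` of the space of variables and
arbitrary elements takes the tuple of functions `θ` to the tuple of functions `θ'`. -/
def Takes (Ω : Set Vars) (Φ : Vars → Vars) (Θ : Vars → Values → Values) (θ θ' : Elements) : Prop :=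
  ∀ p ∈ Ω, θ' (Φ p).1 = Θ p (θ p.1)

/-- `(t, x, u, θ) ↦ (Φ (t, x, u), Θ (t, x, u) θ)` is (over `Ω`) a transformation from the usual
equivalence group of the class given by `V`: a point transformation of the joint space of variables
and arbitrary elements that is projectable to the space of variables and preserves the class, that
is, it takes the tuples of arbitrary elements of equations of the class onto such tuples, with its
component `Φ` mapping the respective equations to each other. -/
structure IsUsualEquivalence (V : Set Values) (Ω : Set Vars) (Φ : Vars → Vars)
    (Θ : Vars → Values → Values) : Prop where
  point : IsPointTransformation Ω Φ
  smooth : ContDiffOn ℝ ∞ (fun q : Vars × Values => Θ q.1 q.2) (Ω ×ˢ V)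
  injective : ∀ p ∈ Ω, Set.InjOn (Θ p) V
  preserves : ∀ θ ∈ elementsOn V (times Ω),
    ∃ θ' ∈ elementsOn V (times (Φ '' Ω)), Takes Ω Φ Θ θ θ' ∧ MapsEquation Ω Φ θ θ'
  onto : ∀ θ' ∈ elementsOn V (times (Φ '' Ω)),
    ∃ θ ∈ elementsOn V (times Ω), Takes Ω Φ Θ θ θ' ∧ MapsEquation Ω Φ θ θ'

/-- The class given by `V` is normalized in the usual sense: every admissible transformation is
induced by a transformation from the usual equivalence group. -/
def IsNormalizedUsual (V : Set Values) : Prop :=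
  ∀ Ω : Set Vars, IsVarDomain Ω → ∀ (θ θ' : Elements) (Φ : Vars → Vars),
    IsAdmissible V Ω θ θ' Φ →
    ∃ Θ : Vars → Values → Values, IsUsualEquivalence V Ω Φ Θ ∧ Takes Ω Φ Θ θ θ'

/-- The action on the values of arbitrary elements at time `t`. -/
noncomputable def newValues (α β γ φ : ℝ → ℝ) (t : ℝ) (v : Values) : Values
  | .a => β t ^ 3 / (deriv α t * φ t) * v .a
  | .b => β t ^ 3 / (deriv α t * φ t) * v .b
  | .c => β t / (deriv α t * φ t ^ 2) * v .c
  | .f => β t / (deriv α t * φ t) * v .f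
  | .g => β t ^ 5 / deriv α t * v .g
  | .h => β t ^ 3 / deriv α t * v .h
  | .m => 1 / deriv α t * (v .m - deriv φ t / φ t)
  | .n => β t / deriv α t * (v .n + deriv (fun s => γ s / β s) t - v .k * (γ t / β t))
  | .k => 1 / deriv α t * (v .k + deriv β t / β t)

/-- The transformation is over `Ω`, on the class given by `V`, of the form
`t̃ = α(t)`, `x̃ = β(t) x + γ(t)`, `ũ = φ(t) u`, with the arbitrary elements transformed by
`newValues`, where `α`, `β`, `γ`, `φ` are smooth functions of `t` and `α_t β φ ≠ 0`. -/
def HasGroupForm (V : Set Values) (Ω : Set Vars) (Φ : Vars → Vars)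
    (Θ : Vars → Values → Values) : Prop :=
  ∃ α β γ φ : ℝ → ℝ,
    ContDiffOn ℝ ∞ α (times Ω) ∧ ContDiffOn ℝ ∞ β (times Ω) ∧
    ContDiffOn ℝ ∞ γ (times Ω) ∧ ContDiffOn ℝ ∞ φ (times Ω) ∧
    (∀ t ∈ times Ω, deriv α t * β t * φ t ≠ 0) ∧
    ∀ t x u : ℝ, (t, x, u) ∈ Ω →
      Φ (t, x, u) = (α t, β t * x + γ t, φ t * u) ∧
      ∀ v ∈ V, Θ (t, x, u) v = newValues α β γ φ t v

/-! ### Expansions of finite order and the derivatives they determine -/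

open Asymptotics Filter

/-! That transformations of the stated form are equivalences is the chain rule: they multiply the
left-hand side by `φ / α_t` (`lhs_of_groupForm`), and their action on the arbitrary elements is
invertible and keeps the conditions of the subclass.

The converse recovers `Φ = (T, X, U)` from one admissible transformation. Instead of prolonging `Φ`
to fifth order, two functions are compared whose jets lie on the same equation and differ in a
controlled way. The effect of `Φ` on the difference is needed only to leading order, which is a
little-o expansion at one point (`MapsEquation.perturbation`).

A term `(t̃ - t̃₀)^5` is invisible to the target equation, which is of first order in `t`. Pulled
back, it changes `u_xxxxx` by a multiple of `(D_x T)^5`, so `D_x T = 0` for all admitted first-order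
jets and `T = α(t)`. Trading `u_t` against `u_xxxxx` gives `g (D_x X)^5 = g' T_t`, with `g'` the
target coefficient; varying the jet yields `X_u = 0`, and then `g X_x^5 = g' α_t`. As the fifth
power is injective, `X = β(t) x + γ(t)`.

Undoing `α`, `β`, `γ` leaves a map `ũ = V(t, x, u)` (`MapsEquation.reduce`). The equation does not
contain `u_xxxx`, so a quartic term may be added to a solution jet; its image contributes `D_x V_u`
to the fifth order. Hence `V_u = φ(t)`. Comparing the factors of `u_xxx` and `u_x` as polynomials in
`u` then removes the free term of `V`: here `f = h = 0` and `(a, c) ≠ (0, 0)` are decisive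
(`MapsByFiber.eq_mul`).

Finally, the equation as a manifold determines its tuple (`elements_eq_of_lhs_iff`). So `Φ` and the
source tuple fix the target tuple, which gives both normalization and, through constant tuples, the
form of `Θ`. -/

/-- `f` has at `x` the asymptotic expansion with coefficients `c` up to order `n`. -/
def HasExpansion (f : ℝ → ℝ) (x : ℝ) (c : ℕ → ℝ) (n : ℕ) : Prop :=
  (fun y => f y - ∑ k ∈ Finset.range (n + 1), c k * (y - x) ^ k) =o[𝓝 x] fun y => (y - x) ^ n

/-- The limit at `x` kills the constant term, and division by `y - x` lowers the order. The
punctured neighbourhood makes this division legitimate. -/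
theorem coeff_eq_zero_of_isLittleO {x : ℝ} {n : ℕ} {c : ℕ → ℝ}
    (h : (fun y => ∑ k ∈ Finset.range (n + 1), c k * (y - x) ^ k) =o[𝓝[≠] x]
      fun y => (y - x) ^ n) : ∀ k ≤ n, c k = 0 := by
  induction n generalizing c with
  | zero =>
    intro k hk
    obtain rfl : k = 0 := by omega
    simp only [zero_add, Finset.range_one, Finset.sum_singleton, pow_zero, mul_one] at h
    simpa using (isLittleO_const_const_iff.1 h)
  | succ n ih =>
    have h0 : c 0 = 0 := by
      have h1 : Tendsto (fun y => ∑ k ∈ Finset.range (n + 1 + 1), c k * (y - x) ^ k)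
          (𝓝[≠] x) (𝓝 0) := by
        refine h.isBigO.trans_tendsto ?_
        have : Tendsto (fun y : ℝ => (y - x) ^ (n + 1)) (𝓝 x) (𝓝 ((x - x) ^ (n + 1))) :=
          Continuous.tendsto (by fun_prop) x
        simpa using this.mono_left nhdsWithin_le_nhds
      have h2 : Tendsto (fun y => ∑ k ∈ Finset.range (n + 1 + 1), c k * (y - x) ^ k)
          (𝓝[≠] x) (𝓝 (∑ k ∈ Finset.range (n + 1 + 1), c k * (x - x) ^ k)) :=
        (Continuous.tendsto (by fun_prop) x).mono_left nhdsWithin_le_nhds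
      have h3 := tendsto_nhds_unique h2 h1
      rw [Finset.sum_range_succ'] at h3
      simpa using h3
    have h4 : (fun y => ∑ k ∈ Finset.range (n + 1), c (k + 1) * (y - x) ^ k) =o[𝓝[≠] x]
        fun y => (y - x) ^ n := by
      have h5 := h.mul_isBigO (isBigO_refl (fun y : ℝ => (y - x)⁻¹) (𝓝[≠] x))
      refine h5.congr' ?_ ?_
      · filter_upwards [self_mem_nhdsWithin] with y hy
        have : y - x ≠ 0 := sub_ne_zero.2 hy
        rw [Finset.sum_range_succ', h0, zero_mul, add_zero, Finset.sum_mul]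
        refine Finset.sum_congr rfl fun k _ => ?_
        field_simp
        ring
      · filter_upwards [self_mem_nhdsWithin] with y hy
        have : y - x ≠ 0 := sub_ne_zero.2 hy
        field_simp
        ring
    intro k hk
    rcases k with _ | k
    · exact h0
    · exact ih h4 k (by omega)

theorem HasExpansion.congr {f g : ℝ → ℝ} {x : ℝ} {c : ℕ → ℝ} {n : ℕ}
    (h : HasExpansion f x c n) (hfg : f =ᶠ[𝓝 x] g) : HasExpansion g x c n := by
  refine IsLittleO.congr' h ?_ EventuallyEq.rfl
  filter_upwards [hfg] with y hy
  rw [hy]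

theorem HasExpansion.add {f g : ℝ → ℝ} {x : ℝ} {c d : ℕ → ℝ} {n : ℕ}
    (hf : HasExpansion f x c n) (hg : HasExpansion g x d n) :
    HasExpansion (fun y => f y + g y) x (fun k => c k + d k) n := by
  refine (IsLittleO.add hf hg).congr_left fun y => ?_
  simp only [add_mul, Finset.sum_add_distrib]
  ring

theorem HasExpansion.const_mul {f : ℝ → ℝ} {x : ℝ} {c : ℕ → ℝ} {n : ℕ}
    (hf : HasExpansion f x c n) (a : ℝ) :
    HasExpansion (fun y => a * f y) x (fun k => a * c k) n := by
  refine (IsLittleO.const_mul_left hf a).congr_left fun y => ?_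
  simp only [mul_sub, Finset.mul_sum, mul_assoc]

theorem HasExpansion.of_eq {f : ℝ → ℝ} {x : ℝ} {c : ℕ → ℝ} {n : ℕ}
    (h : ∀ y, f y = ∑ k ∈ Finset.range (n + 1), c k * (y - x) ^ k) : HasExpansion f x c n := by
  refine (isLittleO_zero _ _).congr_left fun y => ?_
  rw [h, sub_self]

theorem HasExpansion.unique {f : ℝ → ℝ} {x : ℝ} {c d : ℕ → ℝ} {n : ℕ}
    (hc : HasExpansion f x c n) (hd : HasExpansion f x d n) : ∀ k ≤ n, c k = d k := by
  have h : (fun y => ∑ k ∈ Finset.range (n + 1), (d k - c k) * (y - x) ^ k) =o[𝓝 x]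
      fun y => (y - x) ^ n := by
    refine (IsLittleO.sub hc hd).congr_left fun y => ?_
    simp only [sub_mul, Finset.sum_sub_distrib]
    ring
  intro k hk
  have := coeff_eq_zero_of_isLittleO (h.mono nhdsWithin_le_nhds) k hk
  linarith

theorem ContDiffAt.hasExpansion {f : ℝ → ℝ} {x : ℝ} {n : ℕ} (hf : ContDiffAt ℝ n f x) :
    HasExpansion f x (fun k => ((k.factorial : ℝ)⁻¹ * iteratedDeriv k f x)) n := by
  obtain ⟨u, hu, hfu⟩ := hf.contDiffOn le_rfl (by simp)
  obtain ⟨r, hr, hru⟩ := Metric.mem_nhds_iff.1 hu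
  have h := taylor_isLittleO (convex_ball x r) (Metric.mem_ball_self hr) (hfu.mono hru)
  rw [Metric.isOpen_ball.nhdsWithin_eq (Metric.mem_ball_self hr)] at h
  refine h.congr_left fun y => ?_
  rw [taylor_within_apply]
  congr 1
  refine Finset.sum_congr rfl fun k _ => ?_
  rw [iteratedDerivWithin_of_isOpen Metric.isOpen_ball (Metric.mem_ball_self hr), smul_eq_mul]
  ring

theorem HasExpansion.iteratedDeriv_eq {f : ℝ → ℝ} {x : ℝ} {c : ℕ → ℝ} {n : ℕ}
    (h : HasExpansion f x c n) (hf : ContDiffAt ℝ n f x) {k : ℕ} (hk : k ≤ n) :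
    iteratedDeriv k f x = k.factorial * c k := by
  rw [h.unique hf.hasExpansion k hk, mul_inv_cancel_left₀ (by positivity)]

theorem HasExpansion.hasDerivAt {f : ℝ → ℝ} {x : ℝ} {c : ℕ → ℝ} (h0 : f x = c 0)
    (h : HasExpansion f x c 1) : HasDerivAt f (c 1) x := by
  rw [hasDerivAt_iff_isLittleO]
  refine IsLittleO.congr h (fun y => ?_) fun y => by simp
  simp [Finset.sum_range_succ, h0]
  ring

theorem isLittleO_pow_sub {x : ℝ} {m n : ℕ} (h : m < n) :
    (fun y : ℝ => (y - x) ^ n) =o[𝓝 x] fun y => (y - x) ^ m := by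
  refine (isLittleO_pow_pow h (𝕜 := ℝ)).comp_tendsto ?_
  exact tendsto_sub_nhds_zero_iff.2 tendsto_id

/-! ### The equation on jets, and polynomials with prescribed jets -/

/-- The left-hand side of the equation in terms of the coefficients `c` of the expansion of the
unknown function in powers of `x` and its derivative `q` with respect to `t`. -/
def jetLhs (θ : Values) (x : ℝ) (c : ℕ → ℝ) (q : ℝ) : ℝ :=
  q + θ .a * c 0 * (6 * c 3) + θ .b * c 1 * (2 * c 2) + θ .c * c 0 ^ 2 * c 1 + θ .f * c 0 * c 1
    + θ .g * (120 * c 5) + θ .h * (6 * c 3) + θ .m * c 0 + θ .n * c 1 + θ .k * x * c 1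

theorem contDiffAt_section_right {v : ℝ × ℝ → ℝ} {t x : ℝ} {n : ℕ∞ω}
    (hv : ContDiffAt ℝ n v (t, x)) : ContDiffAt ℝ n (fun y => v (t, y)) x :=
  ContDiffAt.comp x (g := v) hv (by fun_prop)

theorem contDiffAt_section_left {v : ℝ × ℝ → ℝ} {t x : ℝ} {n : ℕ∞ω}
    (hv : ContDiffAt ℝ n v (t, x)) : ContDiffAt ℝ n (fun s => v (s, x)) t :=
  ContDiffAt.comp t (g := v) hv (by fun_prop)

theorem lhs_eq_jetLhs {θ : Elements} {v : ℝ × ℝ → ℝ} {t x q : ℝ} {c : ℕ → ℝ}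
    (hv : ContDiffAt ℝ ∞ v (t, x)) (hc : HasExpansion (fun y => v (t, y)) x c 5)
    (hq : HasDerivAt (fun s => v (s, x)) q t) : lhs θ v (t, x) = jetLhs (θ t) x c q := by
  have h5 : ContDiffAt ℝ (5 : ℕ) (fun y => v (t, y)) x :=
    contDiffAt_infty.1 (contDiffAt_section_right hv) 5
  have h0 : v (t, x) = c 0 := by
    simpa using hc.iteratedDeriv_eq h5 (k := 0) (by norm_num)
  simp only [lhs, jetLhs, hq.deriv, hc.iteratedDeriv_eq h5 (k := 1) (by norm_num),
    hc.iteratedDeriv_eq h5 (k := 2) (by norm_num), hc.iteratedDeriv_eq h5 (k := 3) (by norm_num),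
    hc.iteratedDeriv_eq h5 (k := 5) (by norm_num), h0]
  simp [Nat.factorial]

/-- Supplies the data required by `lhs_eq_jetLhs` for a function known only to be smooth. -/
theorem exists_lhs_eq_jetLhs {v : ℝ × ℝ → ℝ} {t x : ℝ} (hv : ContDiffAt ℝ ∞ v (t, x)) :
    ∃ c : ℕ → ℝ, ∃ q : ℝ, c 0 = v (t, x) ∧ HasExpansion (fun y => v (t, y)) x c 5 ∧
      HasDerivAt (fun y => v (t, y)) (c 1) x ∧ HasDerivAt (fun s => v (s, x)) q t := by
  have h5 : ContDiffAt ℝ (5 : ℕ) (fun y => v (t, y)) x :=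
    contDiffAt_infty.1 (contDiffAt_section_right hv) 5
  refine ⟨_, _, ?_, h5.hasExpansion, ?_,
    ((contDiffAt_section_left hv).differentiableAt (by simp)).hasDerivAt⟩
  · simp
  · simpa using (h5.differentiableAt (by simp)).hasDerivAt

/-- The polynomial with given expansion in powers of `y - x` and given derivative with respect to
`s` at `s = t`. -/
def jetPoly (t x : ℝ) (c : ℕ → ℝ) (q : ℝ) (r : ℝ × ℝ) : ℝ :=
  ∑ k ∈ Finset.range 6, c k * (r.2 - x) ^ k + q * (r.1 - t)

theorem contDiff_jetPoly (t x : ℝ) (c : ℕ → ℝ) (q : ℝ) {n : ℕ∞ω} : ContDiff ℝ n (jetPoly t x c q) := by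
  unfold jetPoly; fun_prop

theorem jetPoly_self (t x : ℝ) (c : ℕ → ℝ) (q : ℝ) : jetPoly t x c q (t, x) = c 0 := by
  simp [jetPoly, Finset.sum_range_succ]

theorem hasExpansion_jetPoly (t x : ℝ) (c : ℕ → ℝ) (q : ℝ) :
    HasExpansion (fun y => jetPoly t x c q (t, y)) x c 5 :=
  .of_eq fun y => by simp [jetPoly]

theorem hasDerivAt_jetPoly_left (t x : ℝ) (c : ℕ → ℝ) (q : ℝ) :
    HasDerivAt (fun s => jetPoly t x c q (s, x)) q t := by
  have := (((hasDerivAt_id t).sub_const t).const_mul q).const_add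
    (∑ k ∈ Finset.range 6, c k * (x - x) ^ k)
  simpa [jetPoly] using this

theorem hasDerivAt_jetPoly_right (t x : ℝ) (c : ℕ → ℝ) (q : ℝ) :
    HasDerivAt (fun y => jetPoly t x c q (t, y)) (c 1) x := by
  have h : HasDerivAt (fun y : ℝ => y - x) 1 x := (hasDerivAt_id x).sub_const x
  have := ((((((hasDerivAt_const x (c 0)).add (h.const_mul (c 1))).add
    ((h.pow 2).const_mul (c 2))).add ((h.pow 3).const_mul (c 3))).add
    ((h.pow 4).const_mul (c 4))).add ((h.pow 5).const_mul (c 5)))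
  convert! this using 1
  · ext y; simp [jetPoly, Finset.sum_range_succ]
  · simp

theorem lhs_jetPoly (θ : Elements) (t x : ℝ) (c : ℕ → ℝ) (q : ℝ) :
    lhs θ (jetPoly t x c q) (t, x) = jetLhs (θ t) x c q :=
  lhs_eq_jetLhs (contDiff_jetPoly t x c q).contDiffAt (hasExpansion_jetPoly t x c q)
    (hasDerivAt_jetPoly_left t x c q)

/-! ### The chain rule for transformations of the group form -/

theorem iteratedDeriv_comp_affine (F : ℝ → ℝ) (b c : ℝ) (k : ℕ) :
    iteratedDeriv k (fun y => F (b * y + c)) = fun y => b ^ k * iteratedDeriv k F (b * y + c) := by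
  induction k with
  | zero => simp
  | succ k ih =>
    rw [iteratedDeriv_succ, ih]
    ext y
    have h1 : deriv (fun y => iteratedDeriv k F (b * y + c)) y
        = b * deriv (iteratedDeriv k F) (b * y + c) := by
      have := deriv_comp_mul_left b (fun z => iteratedDeriv k F (z + c)) y
      rw [deriv_comp_add_const] at this
      simpa using this
    rw [deriv_const_mul_field, h1, iteratedDeriv_succ]
    ring

theorem deriv_fst_of_differentiableAt {w : ℝ × ℝ → ℝ} {p : ℝ × ℝ} (hw : DifferentiableAt ℝ w p) :
    deriv (fun s => w (s, p.2)) p.1 = fderiv ℝ w p (1, 0) := by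
  have h : HasDerivAt (fun s : ℝ => (s, p.2)) ((1 : ℝ), (0 : ℝ)) p.1 :=
    (hasDerivAt_id p.1).prodMk (hasDerivAt_const p.1 p.2)
  exact (HasFDerivAt.comp_hasDerivAt p.1 (l := w) hw.hasFDerivAt h).deriv

theorem deriv_snd_of_differentiableAt {w : ℝ × ℝ → ℝ} {p : ℝ × ℝ} (hw : DifferentiableAt ℝ w p) :
    deriv (fun y => w (p.1, y)) p.2 = fderiv ℝ w p (0, 1) := by
  have h : HasDerivAt (fun y : ℝ => (p.1, y)) ((0 : ℝ), (1 : ℝ)) p.2 :=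
    (hasDerivAt_const p.2 p.1).prodMk (hasDerivAt_id p.2)
  exact (HasFDerivAt.comp_hasDerivAt p.2 (l := w) hw.hasFDerivAt h).deriv

theorem deriv_comp_curve {w : ℝ × ℝ → ℝ} {a b : ℝ → ℝ} {t : ℝ}
    (hw : DifferentiableAt ℝ w (a t, b t)) (ha : DifferentiableAt ℝ a t)
    (hb : DifferentiableAt ℝ b t) :
    deriv (fun s => w (a s, b s)) t = deriv a t * deriv (fun s => w (s, b t)) (a t)
      + deriv b t * deriv (fun y => w (a t, y)) (b t) := by
  have h := (HasFDerivAt.comp_hasDerivAt t (l := w) hw.hasFDerivAt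
    (ha.hasDerivAt.prodMk hb.hasDerivAt)).deriv
  have e1 := deriv_fst_of_differentiableAt hw
  have e2 := deriv_snd_of_differentiableAt hw
  dsimp only at e1 e2
  rw [e1, e2]
  refine Eq.trans h ?_
  have : ((deriv a t, deriv b t) : ℝ × ℝ) = deriv a t • (1, 0) + deriv b t • (0, 1) := by simp
  rw [this, map_add, map_smul, map_smul]
  rfl

/-- Each `x`-derivative of `w` costs a factor `1 / β`. Solving for the time derivative produces
`(β_t x + γ_t) u_x` and `φ_t u`, which account for the inhomogeneous terms in the new `k`, `n` and
`m`. -/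
theorem lhs_of_groupForm {θ θ' : Elements} {α β γ φ : ℝ → ℝ} {t x : ℝ} {v w : ℝ × ℝ → ℝ}
    (hα : DifferentiableAt ℝ α t) (hβ : DifferentiableAt ℝ β t) (hγ : DifferentiableAt ℝ γ t)
    (hφ : DifferentiableAt ℝ φ t) (hne : deriv α t * β t * φ t ≠ 0)
    (hv : DifferentiableAt ℝ v (t, x)) (hw : DifferentiableAt ℝ w (α t, β t * x + γ t))
    (h : ∀ᶠ r in 𝓝 (t, x), w (α r.1, β r.1 * r.2 + γ r.1) = φ r.1 * v r)
    (hθ : θ' (α t) = newValues α β γ φ t (θ t)) :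
    lhs θ' w (α t, β t * x + γ t) = φ t / deriv α t * lhs θ v (t, x) := by
  obtain ⟨⟨hα0, hβ0⟩, hφ0⟩ : (deriv α t ≠ 0 ∧ β t ≠ 0) ∧ φ t ≠ 0 := by
    simpa only [mul_ne_zero_iff] using hne
  have hx : ∀ᶠ y in 𝓝 x, w (α t, β t * y + γ t) = φ t * v (t, y) :=
    (show ContinuousAt (fun y : ℝ => (t, y)) x by fun_prop).eventually h
  have ht : ∀ᶠ s in 𝓝 t, w (α s, β s * x + γ s) = φ s * v (s, x) :=
    (show ContinuousAt (fun s : ℝ => (s, x)) t by fun_prop).eventually h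
  have hk : ∀ k, iteratedDeriv k (fun y => w (α t, y)) (β t * x + γ t)
      = φ t * iteratedDeriv k (fun y => v (t, y)) x / β t ^ k := by
    intro k
    have h1 := Filter.EventuallyEq.iteratedDeriv_eq k hx
    rw [iteratedDeriv_comp_affine (fun y => w (α t, y)), iteratedDeriv_const_mul_field] at h1
    rw [eq_div_iff (pow_ne_zero _ hβ0), ← h1]
    ring
  have hb : HasDerivAt (fun s => β s * x + γ s) (deriv β t * x + deriv γ t) t :=
    (hβ.hasDerivAt.mul_const x).add hγ.hasDerivAt
  have hvt : DifferentiableAt ℝ (fun s => v (s, x)) t :=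
    DifferentiableAt.comp t (g := v) hv (by fun_prop)
  have h2 := Filter.EventuallyEq.deriv_eq ht
  rw [deriv_comp_curve (b := fun s => β s * x + γ s) hw hα hb.differentiableAt,
    deriv_fun_mul hφ hvt, hb.deriv] at h2
  have h3 := hk 1
  rw [iteratedDeriv_one] at h3
  rw [h3] at h2
  have h4 : deriv (fun s => w (s, β t * x + γ t)) (α t)
      = (deriv φ t * v (t, x) + φ t * deriv (fun s => v (s, x)) t - (deriv β t * x + deriv γ t)
        * (φ t * iteratedDeriv 1 (fun y => v (t, y)) x / β t ^ 1)) / deriv α t := by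
    rw [eq_div_iff hα0]
    linarith
  have h5 : deriv (fun s => γ s / β s) t = (deriv γ t * β t - γ t * deriv β t) / β t ^ 2 :=
    (hγ.hasDerivAt.div hβ.hasDerivAt hβ0).deriv
  have h0 := hk 0
  simp only [iteratedDeriv_zero, pow_zero, div_one] at h0
  simp only [lhs, hk, h4, h0, hθ, newValues, h5]
  field_simp
  ring

/-! ### The action on the arbitrary elements and its inverse -/

/-- The inverse of `newValues α β γ φ t`. -/
noncomputable def oldValues (α β γ φ : ℝ → ℝ) (t : ℝ) (v : Values) : Values
  | .a => deriv α t * φ t / β t ^ 3 * v .a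
  | .b => deriv α t * φ t / β t ^ 3 * v .b
  | .c => deriv α t * φ t ^ 2 / β t * v .c
  | .f => deriv α t * φ t / β t * v .f
  | .g => deriv α t / β t ^ 5 * v .g
  | .h => deriv α t / β t ^ 3 * v .h
  | .m => deriv α t * v .m + deriv φ t / φ t
  | .n => deriv α t / β t * v .n - deriv (fun s => γ s / β s) t
      + (deriv α t * v .k - deriv β t / β t) * (γ t / β t)
  | .k => deriv α t * v .k - deriv β t / β t

theorem newValues_oldValues {α β γ φ : ℝ → ℝ} {t : ℝ} (hne : deriv α t * β t * φ t ≠ 0)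
    (v : Values) : newValues α β γ φ t (oldValues α β γ φ t v) = v := by
  obtain ⟨⟨hα0, hβ0⟩, hφ0⟩ : (deriv α t ≠ 0 ∧ β t ≠ 0) ∧ φ t ≠ 0 := by
    simpa only [mul_ne_zero_iff] using hne
  ext i
  cases i <;> simp only [newValues, oldValues] <;> field_simp <;> ring

theorem oldValues_newValues {α β γ φ : ℝ → ℝ} {t : ℝ} (hne : deriv α t * β t * φ t ≠ 0)
    (v : Values) : oldValues α β γ φ t (newValues α β γ φ t v) = v := by
  obtain ⟨⟨hα0, hβ0⟩, hφ0⟩ : (deriv α t ≠ 0 ∧ β t ≠ 0) ∧ φ t ≠ 0 := by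
    simpa only [mul_ne_zero_iff] using hne
  ext i
  cases i <;> simp only [newValues, oldValues] <;> field_simp <;> ring

theorem mem_subclassValues_iff {v : Values} :
    v ∈ subclassValues ↔ v .g ≠ 0 ∧ v .f = 0 ∧ v .h = 0 ∧ (v .a ≠ 0 ∨ v .c ≠ 0) := by
  have h : (v .a ≠ 0 ∨ v .c ≠ 0) → v .a ^ 2 + v .b ^ 2 + v .c ^ 2 ≠ 0 := by
    rintro (h | h) <;> positivity
  simp only [subclassValues, classValues, Set.mem_ofPred_eq, ne_eq, mul_eq_zero, Prod.mk.injEq,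
    not_or, not_and_or]
  tauto

theorem newValues_mem_subclassValues {α β γ φ : ℝ → ℝ} {t : ℝ}
    (hne : deriv α t * β t * φ t ≠ 0) {v : Values} (hv : v ∈ subclassValues) :
    newValues α β γ φ t v ∈ subclassValues := by
  obtain ⟨⟨hα0, hβ0⟩, hφ0⟩ : (deriv α t ≠ 0 ∧ β t ≠ 0) ∧ φ t ≠ 0 := by
    simpa only [mul_ne_zero_iff] using hne
  rw [mem_subclassValues_iff] at *
  simp [newValues, hv.1, hv.2.1, hv.2.2.1, hα0, hβ0, hφ0, -not_and]
  exact hv.2.2.2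

theorem oldValues_mem_subclassValues {α β γ φ : ℝ → ℝ} {t : ℝ}
    (hne : deriv α t * β t * φ t ≠ 0) {v : Values} (hv : v ∈ subclassValues) :
    oldValues α β γ φ t v ∈ subclassValues := by
  obtain ⟨⟨hα0, hβ0⟩, hφ0⟩ : (deriv α t ≠ 0 ∧ β t ≠ 0) ∧ φ t ≠ 0 := by
    simpa only [mul_ne_zero_iff] using hne
  rw [mem_subclassValues_iff] at *
  simp [oldValues, hv.1, hv.2.1, hv.2.2.1, hα0, hβ0, hφ0, -not_and]
  exact hv.2.2.2

/-! ### Inverting the change of time; admissible group parameters -/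

/-- Rolle's theorem on the interval `I` gives global injectivity. Near each image point the global
inverse agrees with the one from the inverse function theorem, and so is smooth. -/
theorem exists_contDiffOn_leftInverse {I : Set ℝ} (hI : IsOpen I) (hI' : IsPreconnected I)
    {α : ℝ → ℝ} (hα : ContDiffOn ℝ ∞ α I) (hne : ∀ t ∈ I, deriv α t ≠ 0) :
    ∃ σ : ℝ → ℝ, (∀ t ∈ I, σ (α t) = t) ∧ IsOpen (α '' I) ∧ ContDiffOn ℝ ∞ σ (α '' I) := by
  have hd : ∀ t ∈ I, HasStrictDerivAt α (deriv α t) t := fun t ht =>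
    (hα.contDiffAt (hI.mem_nhds ht)).hasStrictDerivAt (by simp)
  have hlt : ∀ a ∈ I, ∀ b ∈ I, a < b → α a ≠ α b := by
    intro a ha b hb hab h
    have hsub : Set.Icc a b ⊆ I := hI'.ordConnected.out ha hb
    obtain ⟨c, hc, hc0⟩ := exists_deriv_eq_zero hab (hα.continuousOn.mono hsub) h
    exact hne c (hsub (Set.Ioo_subset_Icc_self hc)) hc0
  have hinj : Set.InjOn α I := by
    intro a ha b hb h
    rcases lt_trichotomy a b with hab | hab | hab
    · exact absurd h (hlt a ha b hb hab)
    · exact hab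
    · exact absurd h.symm (hlt b hb a ha hab)
  have hσ : ∀ t ∈ I, Function.invFunOn α I (α t) = t := fun t ht => hinj.leftInvOn_invFunOn ht
  refine ⟨Function.invFunOn α I, hσ, ?_, ?_⟩
  · rw [isOpen_iff_mem_nhds]
    rintro _ ⟨t, ht, rfl⟩
    rw [← (hd t ht).map_nhds_eq (hne t ht)]
    exact image_mem_map (hI.mem_nhds ht)
  · rintro _ ⟨t, ht, rfl⟩
    have hf := hα.contDiffAt (hI.mem_nhds ht)
    have hs := (hd t ht).hasStrictFDerivAt_equiv (hne t ht)
    have hg := hf.to_localInverse hs.hasFDerivAt (by simp)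
    have h1 : ∀ᶠ y in 𝓝 (α t), α (hf.localInverse hs.hasFDerivAt (by simp) y) = y :=
      hs.eventually_right_inverse
    have h2 : ∀ᶠ y in 𝓝 (α t), hf.localInverse hs.hasFDerivAt (by simp) y ∈ I := by
      refine hg.continuousAt.eventually_mem ?_
      rw [hf.localInverse_apply_image]
      exact hI.mem_nhds ht
    refine (hg.congr_of_eventuallyEq ?_).contDiffWithinAt
    filter_upwards [h1, h2] with y hy1 hy2
    conv_lhs => rw [← hy1]
    exact hσ _ hy2

theorem isOpen_times {Ω : Set Vars} (hΩ : IsOpen Ω) : IsOpen (times Ω) := isOpenMap_fst _ hΩ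

theorem IsVarDomain.isPreconnected_times {Ω : Set Vars} (hΩ : IsVarDomain Ω) :
    IsPreconnected (times Ω) :=
  hΩ.isConnected.isPreconnected.image _ continuous_fst.continuousOn

theorem mem_times {Ω : Set Vars} {t x u : ℝ} (h : (t, x, u) ∈ Ω) : t ∈ times Ω := ⟨_, h, rfl⟩

/-- `α`, `β`, `γ` and `φ` are smooth on `I` with `α_t β φ ≠ 0`. -/
structure IsGroupParameter (I : Set ℝ) (α β γ φ : ℝ → ℝ) : Prop where
  isOpen : IsOpen I
  isPreconnected : IsPreconnected I
  smooth_α : ContDiffOn ℝ ∞ α I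
  smooth_β : ContDiffOn ℝ ∞ β I
  smooth_γ : ContDiffOn ℝ ∞ γ I
  smooth_φ : ContDiffOn ℝ ∞ φ I
  ne_zero : ∀ t ∈ I, deriv α t * β t * φ t ≠ 0

namespace IsGroupParameter

variable {I : Set ℝ} {α β γ φ : ℝ → ℝ}

theorem deriv_ne_zero (h : IsGroupParameter I α β γ φ) {t : ℝ} (ht : t ∈ I) : deriv α t ≠ 0 :=
  left_ne_zero_of_mul (left_ne_zero_of_mul (h.ne_zero t ht))

theorem β_ne_zero (h : IsGroupParameter I α β γ φ) {t : ℝ} (ht : t ∈ I) : β t ≠ 0 :=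
  right_ne_zero_of_mul (left_ne_zero_of_mul (h.ne_zero t ht))

theorem φ_ne_zero (h : IsGroupParameter I α β γ φ) {t : ℝ} (ht : t ∈ I) : φ t ≠ 0 :=
  right_ne_zero_of_mul (h.ne_zero t ht)

theorem contDiffAt (h : IsGroupParameter I α β γ φ) {t : ℝ} (ht : t ∈ I) :
    ContDiffAt ℝ ∞ α t ∧ ContDiffAt ℝ ∞ β t ∧ ContDiffAt ℝ ∞ γ t ∧ ContDiffAt ℝ ∞ φ t :=
  ⟨h.smooth_α.contDiffAt (h.isOpen.mem_nhds ht), h.smooth_β.contDiffAt (h.isOpen.mem_nhds ht),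
    h.smooth_γ.contDiffAt (h.isOpen.mem_nhds ht), h.smooth_φ.contDiffAt (h.isOpen.mem_nhds ht)⟩

theorem lhs_eq (h : IsGroupParameter I α β γ φ) {θ θ' : Elements} {t x : ℝ} (ht : t ∈ I)
    (hθ : θ' (α t) = newValues α β γ φ t (θ t)) {v w : ℝ × ℝ → ℝ}
    (hv : ContDiffAt ℝ ∞ v (t, x)) (hw : ContDiffAt ℝ ∞ w (α t, β t * x + γ t))
    (hvw : ∀ᶠ r in 𝓝 (t, x), w (α r.1, β r.1 * r.2 + γ r.1) = φ r.1 * v r) :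
    lhs θ' w (α t, β t * x + γ t) = 0 ↔ lhs θ v (t, x) = 0 := by
  obtain ⟨h1, h2, h3, h4⟩ := h.contDiffAt ht
  rw [lhs_of_groupForm (h1.differentiableAt (by simp)) (h2.differentiableAt (by simp))
    (h3.differentiableAt (by simp)) (h4.differentiableAt (by simp)) (h.ne_zero t ht)
    (hv.differentiableAt (by simp)) (hw.differentiableAt (by simp)) hvw hθ, mul_eq_zero,
    or_iff_right (div_ne_zero (h.φ_ne_zero ht) (h.deriv_ne_zero ht))]

theorem smooth_derivs (h : IsGroupParameter I α β γ φ) :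
    ContDiffOn ℝ ∞ (deriv α) I ∧ ContDiffOn ℝ ∞ (deriv β) I ∧ ContDiffOn ℝ ∞ (deriv φ) I ∧
      ContDiffOn ℝ ∞ (deriv fun s => γ s / β s) I :=
  ⟨h.smooth_α.deriv_of_isOpen h.isOpen (by simp), h.smooth_β.deriv_of_isOpen h.isOpen (by simp),
    h.smooth_φ.deriv_of_isOpen h.isOpen (by simp),
    (h.smooth_γ.div h.smooth_β fun _ => h.β_ne_zero).deriv_of_isOpen h.isOpen (by simp)⟩

theorem smooth_newValues_oldValues (h : IsGroupParameter I α β γ φ) :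
    ContDiffOn ℝ ∞ (fun q : ℝ × Values => newValues α β γ φ q.1 q.2) (I ×ˢ Set.univ) ∧
    ContDiffOn ℝ ∞ (fun q : ℝ × Values => oldValues α β γ φ q.1 q.2) (I ×ˢ Set.univ) := by
  have hfst : ContDiffOn ℝ ∞ (Prod.fst : ℝ × Values → ℝ) (I ×ˢ Set.univ) := contDiff_fst.contDiffOn
  have hm : Set.MapsTo (Prod.fst : ℝ × Values → ℝ) (I ×ˢ Set.univ) I := fun q hq => hq.1
  have lift : ∀ {f : ℝ → ℝ}, ContDiffOn ℝ ∞ f I →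
      ContDiffOn ℝ ∞ (fun q : ℝ × Values => f q.1) (I ×ˢ Set.univ) := fun hf => hf.comp hfst hm
  have val : ∀ i, ContDiffOn ℝ ∞ (fun q : ℝ × Values => q.2 i) (I ×ˢ Set.univ) := fun i =>
    ((contDiff_apply ℝ ℝ i).comp contDiff_snd).contDiffOn
  obtain ⟨dα, dβ, dφ, dγ⟩ := h.smooth_derivs
  replace dα := lift dα
  replace dβ := lift dβ
  replace dφ := lift dφ
  replace dγ := lift dγ
  have sβ := lift h.smooth_β
  have sγ := lift h.smooth_γ
  have sφ := lift h.smooth_φ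
  have nα : ∀ q ∈ I ×ˢ (Set.univ : Set Values), deriv α q.1 ≠ 0 := fun q hq => h.deriv_ne_zero hq.1
  have nβ : ∀ q ∈ I ×ˢ (Set.univ : Set Values), β q.1 ≠ 0 := fun q hq => h.β_ne_zero hq.1
  have nφ : ∀ q ∈ I ×ˢ (Set.univ : Set Values), φ q.1 ≠ 0 := fun q hq => h.φ_ne_zero hq.1
  constructor
  · refine contDiffOn_pi.2 fun i => ?_
    cases i <;> simp only [newValues]
    · exact ((sβ.pow 3).div (dα.mul sφ) fun q hq => mul_ne_zero (nα q hq) (nφ q hq)).mul (val _)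
    · exact ((sβ.pow 3).div (dα.mul sφ) fun q hq => mul_ne_zero (nα q hq) (nφ q hq)).mul (val _)
    · exact (sβ.div (dα.mul (sφ.pow 2)) fun q hq =>
        mul_ne_zero (nα q hq) (pow_ne_zero _ (nφ q hq))).mul (val _)
    · exact (sβ.div (dα.mul sφ) fun q hq => mul_ne_zero (nα q hq) (nφ q hq)).mul (val _)
    · exact ((sβ.pow 5).div dα nα).mul (val _)
    · exact ((sβ.pow 3).div dα nα).mul (val _)
    · exact (contDiffOn_const.div dα nα).mul ((val _).sub (dφ.div sφ nφ))
    · exact (sβ.div dα nα).mul (((val _).add dγ).sub ((val _).mul (sγ.div sβ nβ)))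
    · exact (contDiffOn_const.div dα nα).mul ((val _).add (dβ.div sβ nβ))
  · refine contDiffOn_pi.2 fun i => ?_
    cases i <;> simp only [oldValues]
    · exact ((dα.mul sφ).div (sβ.pow 3) fun q hq => pow_ne_zero _ (nβ q hq)).mul (val _)
    · exact ((dα.mul sφ).div (sβ.pow 3) fun q hq => pow_ne_zero _ (nβ q hq)).mul (val _)
    · exact ((dα.mul (sφ.pow 2)).div sβ nβ).mul (val _)
    · exact ((dα.mul sφ).div sβ nβ).mul (val _)
    · exact (dα.div (sβ.pow 5) fun q hq => pow_ne_zero _ (nβ q hq)).mul (val _)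
    · exact (dα.div (sβ.pow 3) fun q hq => pow_ne_zero _ (nβ q hq)).mul (val _)
    · exact (dα.mul (val _)).add (dφ.div sφ nφ)
    · exact (((dα.div sβ nβ).mul (val _)).sub dγ).add
        (((dα.mul (val _)).sub (dβ.div sβ nβ)).mul (sγ.div sβ nβ))
    · exact (dα.mul (val _)).sub (dβ.div sβ nβ)

end IsGroupParameter

/-! ### Equations mapped by the group form, and reduction to maps of `u` alone -/

theorem eventually_mem_graph {Ω : Set Vars} (hΩ : IsOpen Ω) {v : ℝ × ℝ → ℝ} {t x u : ℝ}
    (hp : (t, x, u) ∈ Ω) (hv : ContinuousAt v (t, x)) (hu : v (t, x) = u) :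
    ∀ᶠ r in 𝓝 (t, x), (r.1, r.2, v r) ∈ Ω := by
  have : ContinuousAt (fun r : ℝ × ℝ => ((r.1, r.2, v r) : Vars)) (t, x) := by fun_prop
  exact this.eventually_mem (by simpa [hu] using hΩ.mem_nhds hp)

theorem image_fst_eq {Ω : Set Vars} {Φ : Vars → Vars} {α : ℝ → ℝ}
    (h : ∀ p ∈ Ω, (Φ p).1 = α p.1) : times (Φ '' Ω) = α '' times Ω := by
  ext s
  simp only [times, Set.mem_image, exists_exists_and_eq_and]
  refine exists_congr fun p => and_congr_right fun hp => by rw [h p hp]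

theorem mapsEquation_of_groupForm {Ω : Set Vars} (hΩ : IsOpen Ω) {Φ : Vars → Vars}
    {α β γ φ : ℝ → ℝ} (hg : IsGroupParameter (times Ω) α β γ φ)
    (hΦ : ∀ t x u : ℝ, (t, x, u) ∈ Ω → Φ (t, x, u) = (α t, β t * x + γ t, φ t * u))
    {θ θ' : Elements} (hθ : ∀ t ∈ times Ω, θ' (α t) = newValues α β γ φ t (θ t)) :
    MapsEquation Ω Φ θ θ' := by
  intro t x u hp v w hv hu hw hvw
  have ht := mem_times hp
  rw [hΦ t x u hp] at hw ⊢
  refine (hg.lhs_eq ht (hθ t ht) hv hw ?_).symm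
  filter_upwards [hvw, eventually_mem_graph hΩ hp hv.continuousAt hu] with r hr hr'
  simpa [hΦ _ _ _ hr'] using hr

/-- The change of `(t, x)` is invertible near the point, so every smooth `v` has an explicit smooth
image `w` there. Composing with the inverse group transformation replaces `w` by `V` along the graph
of `v`. Nondegeneracy of `V` in `u` plays no role. -/
theorem MapsEquation.reduce {Ω : Set Vars} (hΩ : IsOpen Ω) {Φ : Vars → Vars}
    {α β γ φ : ℝ → ℝ} (hg : IsGroupParameter (times Ω) α β γ φ) {V : Vars → ℝ}
    (hV : ContDiffOn ℝ ∞ V Ω)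
    (hΦ : ∀ t x u : ℝ, (t, x, u) ∈ Ω → Φ (t, x, u) = (α t, β t * x + γ t, φ t * V (t, x, u)))
    {θ θ' : Elements} (h : MapsEquation Ω Φ θ θ') {t x u : ℝ} (hp : (t, x, u) ∈ Ω)
    {v : ℝ × ℝ → ℝ} (hv : ContDiffAt ℝ ∞ v (t, x)) (hu : v (t, x) = u) :
    lhs θ v (t, x) = 0 ↔
      lhs (fun s => oldValues α β γ φ s (θ' (α s))) (fun r => V (r.1, r.2, v r)) (t, x) = 0 := by
  have ht := mem_times hp
  obtain ⟨σ, hσ, ho, hσs⟩ := exists_contDiffOn_leftInverse hg.isOpen hg.isPreconnected hg.smooth_α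
    fun s => hg.deriv_ne_zero
  have hσt : ContDiffAt ℝ ∞ σ (α t) := hσs.contDiffAt (ho.mem_nhds ⟨t, ht, rfl⟩)
  obtain ⟨-, cβ, cγ, cφ⟩ := hg.contDiffAt ht
  have hVv : ContDiffAt ℝ ∞ (fun r : ℝ × ℝ => V (r.1, r.2, v r)) (t, x) := by
    refine ContDiffAt.comp (t, x) (g := V) (f := fun r : ℝ × ℝ => (r.1, r.2, v r)) ?_
      (contDiffAt_fst.prodMk (contDiffAt_snd.prodMk hv))
    simpa [hu] using hV.contDiffAt (hΩ.mem_nhds hp)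
  let ψ : ℝ × ℝ → ℝ × ℝ := fun r => (σ r.1, (r.2 - γ (σ r.1)) / β (σ r.1))
  let w : ℝ × ℝ → ℝ := fun r => φ (σ r.1) * V ((ψ r).1, (ψ r).2, v (ψ r))
  have hψ : ∀ s ∈ times Ω, ∀ y, ψ (α s, β s * y + γ s) = (s, y) := by
    intro s hs y
    have := hg.β_ne_zero hs
    simp only [ψ, hσ s hs, add_sub_cancel_right, mul_div_cancel_left₀ _ this]
  have hσ1 : ContDiffAt ℝ ∞ (fun r : ℝ × ℝ => σ r.1) (α t, β t * x + γ t) :=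
    ContDiffAt.comp _ (g := σ) hσt contDiffAt_fst
  have lift : ∀ {f : ℝ → ℝ}, ContDiffAt ℝ ∞ f t →
      ContDiffAt ℝ ∞ (fun r : ℝ × ℝ => f (σ r.1)) (α t, β t * x + γ t) := fun {f} hf =>
    ContDiffAt.comp (α t, β t * x + γ t) (g := f) (f := fun r : ℝ × ℝ => σ r.1)
      (by simpa [hσ t ht] using hf) hσ1
  have hψs : ContDiffAt ℝ ∞ ψ (α t, β t * x + γ t) :=
    hσ1.prodMk ((contDiffAt_snd.sub (lift cγ)).div (lift cβ)
      (by simpa [hσ t ht] using hg.β_ne_zero ht))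
  have hw : ContDiffAt ℝ ∞ w (α t, β t * x + γ t) :=
    (lift cφ).mul (ContDiffAt.comp (α t, β t * x + γ t)
      (g := fun r : ℝ × ℝ => V (r.1, r.2, v r)) (f := ψ) (by rwa [hψ t ht]) hψs)
  have hI : ∀ᶠ r : ℝ × ℝ in 𝓝 (t, x), r.1 ∈ times Ω :=
    continuousAt_fst.eventually_mem (hg.isOpen.mem_nhds ht)
  have hw' : ∀ᶠ r in 𝓝 (t, x),
      w (α r.1, β r.1 * r.2 + γ r.1) = φ r.1 * V (r.1, r.2, v r) := by
    filter_upwards [hI] with r hr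
    simp only [w, hψ r.1 hr, hσ r.1 hr]
  have hmaps : MapsGraph Φ v w (t, x) := by
    filter_upwards [hw', eventually_mem_graph hΩ hp hv.continuousAt hu] with r hr hr'
    simpa [hΦ _ _ _ hr'] using hr
  have key := h t x u hp v w hv hu (by simpa [hΦ t x u hp] using hw) hmaps
  rw [hΦ t x u hp] at key
  rw [key]
  exact hg.lhs_eq ht (by rw [newValues_oldValues (hg.ne_zero t ht)]) hVv hw hw'

/-! ### Transformations of the group form are usual equivalences -/

theorem det_ne_zero_iff_injective (L : Vars →L[ℝ] Vars) :
    L.det ≠ 0 ↔ Function.Injective L := by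
  rw [ContinuousLinearMap.det, Ne, LinearMap.det_eq_zero_iff_ker_ne_bot, not_not,
    LinearMap.ker_eq_bot]
  rfl

theorem HasGroupForm.isGroupParameter {V : Set Values} {Ω : Set Vars} (hΩ : IsVarDomain Ω)
    {Φ : Vars → Vars} {Θ : Vars → Values → Values} (h : HasGroupForm V Ω Φ Θ) :
    ∃ α β γ φ : ℝ → ℝ, IsGroupParameter (times Ω) α β γ φ ∧
      ∀ t x u : ℝ, (t, x, u) ∈ Ω → Φ (t, x, u) = (α t, β t * x + γ t, φ t * u) ∧
        ∀ v ∈ V, Θ (t, x, u) v = newValues α β γ φ t v := by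
  obtain ⟨α, β, γ, φ, h1, h2, h3, h4, h5, h6⟩ := h
  exact ⟨α, β, γ, φ, ⟨isOpen_times hΩ.isOpen, hΩ.isPreconnected_times, h1, h2, h3, h4, h5⟩, h6⟩

theorem IsGroupParameter.isPointTransformation {Ω : Set Vars} (hΩ : IsOpen Ω) {Φ : Vars → Vars}
    {α β γ φ : ℝ → ℝ} (hg : IsGroupParameter (times Ω) α β γ φ)
    (hΦ : ∀ t x u : ℝ, (t, x, u) ∈ Ω → Φ (t, x, u) = (α t, β t * x + γ t, φ t * u)) :
    IsPointTransformation Ω Φ := by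
  have hfst : ContDiffOn ℝ ∞ (Prod.fst : Vars → ℝ) Ω := contDiff_fst.contDiffOn
  have hm : Set.MapsTo (Prod.fst : Vars → ℝ) Ω (times Ω) := fun q hq => ⟨q, hq, rfl⟩
  constructor
  · refine ContDiffOn.congr (f := fun p : Vars => (α p.1, β p.1 * p.2.1 + γ p.1, φ p.1 * p.2.2)) ?_
      fun p hp => hΦ p.1 p.2.1 p.2.2 hp
    have hx : ContDiffOn ℝ ∞ (fun p : Vars => p.2.1) Ω := by fun_prop
    have hu : ContDiffOn ℝ ∞ (fun p : Vars => p.2.2) Ω := by fun_prop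
    exact (hg.smooth_α.comp hfst hm).prodMk
      ((((hg.smooth_β.comp hfst hm).mul hx).add (hg.smooth_γ.comp hfst hm)).prodMk
        ((hg.smooth_φ.comp hfst hm).mul hu))
  · intro p hp
    have ht : p.1 ∈ times Ω := ⟨p, hp, rfl⟩
    obtain ⟨h1, h2, h3, h4⟩ := hg.contDiffAt ht
    have lift : ∀ {f : ℝ → ℝ}, ContDiffAt ℝ ∞ f p.1 →
        HasFDerivAt (fun p : Vars => f p.1) (deriv f p.1 • ContinuousLinearMap.fst ℝ ℝ (ℝ × ℝ)) p :=
      fun hf => (hf.differentiableAt (by simp)).hasDerivAt.comp_hasFDerivAt p hasFDerivAt_fst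
    have hx : HasFDerivAt (fun p : Vars => p.2.1)
        ((ContinuousLinearMap.fst ℝ ℝ ℝ).comp (ContinuousLinearMap.snd ℝ ℝ (ℝ × ℝ))) p :=
      HasFDerivAt.comp p (hasFDerivAt_fst (𝕜 := ℝ) (p := p.2)) hasFDerivAt_snd
    have hu : HasFDerivAt (fun p : Vars => p.2.2)
        ((ContinuousLinearMap.snd ℝ ℝ ℝ).comp (ContinuousLinearMap.snd ℝ ℝ (ℝ × ℝ))) p :=
      HasFDerivAt.comp p (hasFDerivAt_snd (𝕜 := ℝ) (p := p.2)) hasFDerivAt_snd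
    have hd := (lift h1).prodMk ((((lift h2).mul hx).add (lift h3)).prodMk ((lift h4).mul hu))
    have heq : Φ =ᶠ[𝓝 p] fun p : Vars => (α p.1, β p.1 * p.2.1 + γ p.1, φ p.1 * p.2.2) := by
      filter_upwards [hΩ.mem_nhds hp] with q hq using hΦ q.1 q.2.1 q.2.2 hq
    rw [(hd.congr_of_eventuallyEq heq).fderiv, det_ne_zero_iff_injective,
      injective_iff_map_eq_zero]
    -- The Jacobian is triangular: the first component forces `a = 0`, after which the other two
    -- involve only `β b` and `φ c`.
    rintro ⟨a, b, c⟩ h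
    simp only [ContinuousLinearMap.prod_apply, Prod.mk_eq_zero, add_apply,
      smul_apply, ContinuousLinearMap.coe_fst', ContinuousLinearMap.coe_snd',
      ContinuousLinearMap.comp_apply, smul_eq_mul] at h
    obtain ⟨ha, hb, hc⟩ := h
    obtain rfl : a = 0 := (mul_eq_zero.1 ha).resolve_left (hg.deriv_ne_zero ht)
    simp only [mul_zero, add_zero, mul_eq_zero, hg.β_ne_zero ht, hg.φ_ne_zero ht, false_or] at hb hc
    simp [hb, hc]

theorem HasGroupForm.isUsualEquivalence {Ω : Set Vars} (hΩ : IsVarDomain Ω)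
    {Φ : Vars → Vars} {Θ : Vars → Values → Values} (h : HasGroupForm subclassValues Ω Φ Θ) :
    IsUsualEquivalence subclassValues Ω Φ Θ := by
  obtain ⟨α, β, γ, φ, hg, h⟩ := h.isGroupParameter hΩ
  have hΦ := fun t x u hp => (h t x u hp).1
  have hΘ := fun t x u hp => (h t x u hp).2
  have htimes : times (Φ '' Ω) = α '' times Ω :=
    image_fst_eq fun p hp => by rw [show p = (p.1, p.2.1, p.2.2) from rfl, hΦ _ _ _ hp]
  obtain ⟨σ, hσ, ho, hσs⟩ := exists_contDiffOn_leftInverse hg.isOpen hg.isPreconnected hg.smooth_α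
    fun s => hg.deriv_ne_zero
  have hσm : Set.MapsTo σ (α '' times Ω) (times Ω) := by
    rintro _ ⟨s, hs, rfl⟩
    rwa [hσ s hs]
  refine ⟨hg.isPointTransformation hΩ.isOpen hΦ, ?_, ?_, ?_, ?_⟩
  · have hf : ContDiffOn ℝ ∞ (fun q : Vars × Values => (q.1.1, q.2)) (Ω ×ˢ subclassValues) := by
      fun_prop
    refine (hg.smooth_newValues_oldValues.1.comp hf fun q hq => ⟨⟨q.1, hq.1, rfl⟩, trivial⟩).congr ?_
    exact fun q hq => hΘ _ _ _ hq.1 _ hq.2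
  · intro p hp v hv v' hv' hvv
    rw [show p = (p.1, p.2.1, p.2.2) from rfl, hΘ _ _ _ hp v hv, hΘ _ _ _ hp v' hv'] at hvv
    have hne := hg.ne_zero p.1 ⟨p, hp, rfl⟩
    rw [← oldValues_newValues (γ := γ) hne v, hvv, oldValues_newValues hne]
  · rintro θ ⟨hθs, hθm⟩
    refine ⟨fun s => newValues α β γ φ (σ s) (θ (σ s)), ⟨?_, ?_⟩, ?_, ?_⟩
    · rw [htimes]
      exact hg.smooth_newValues_oldValues.1.comp (hσs.prodMk (hθs.comp hσs hσm))
        fun s hs => ⟨hσm hs, trivial⟩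
    · rw [htimes]
      exact fun s hs => newValues_mem_subclassValues (hg.ne_zero _ (hσm hs)) (hθm _ (hσm hs))
    · rintro ⟨t, x, u⟩ hp
      have ht := mem_times hp
      rw [hΦ t x u hp, hΘ t x u hp _ (hθm t ht)]
      simp only [hσ t ht]
    · refine mapsEquation_of_groupForm hΩ.isOpen hg hΦ fun t ht => ?_
      simp only [hσ t ht]
  · rintro θ' ⟨hθs, hθm⟩
    rw [htimes] at hθs hθm
    have hmem : ∀ t ∈ times Ω, oldValues α β γ φ t (θ' (α t)) ∈ subclassValues := fun t ht =>
      oldValues_mem_subclassValues (hg.ne_zero t ht) (hθm _ ⟨t, ht, rfl⟩)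
    refine ⟨fun t => oldValues α β γ φ t (θ' (α t)), ⟨?_, hmem⟩, ?_, ?_⟩
    · exact hg.smooth_newValues_oldValues.2.comp
        (contDiffOn_id.prodMk (hθs.comp hg.smooth_α fun t ht => ⟨t, ht, rfl⟩))
        fun t ht => ⟨ht, trivial⟩
    · rintro ⟨t, x, u⟩ hp
      have ht := mem_times hp
      rw [hΦ t x u hp, hΘ t x u hp _ (hmem t ht), newValues_oldValues (hg.ne_zero t ht)]
    · refine mapsEquation_of_groupForm hΩ.isOpen hg hΦ fun t ht => ?_
      rw [newValues_oldValues (hg.ne_zero t ht)]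

/-! ### Functions that depend on `t` alone -/

/-- This is where connectedness of the sections `t = const` enters: local constancy in `(x, u)`
becomes constancy. -/
theorem IsVarDomain.exists_eq_of_section_deriv {Ω : Set Vars} (hΩ : IsVarDomain Ω) {F : Vars → ℝ}
    (hF : ∀ p ∈ Ω, HasFDerivAt (fun q : ℝ × ℝ => F (p.1, q)) (0 : ℝ × ℝ →L[ℝ] ℝ) p.2) :
    ∃ f : ℝ → ℝ, ∀ p ∈ Ω, F p = f p.1 := by
  have h : ∀ t, ∃ a, ∀ q : ℝ × ℝ, (t, q) ∈ Ω → F (t, q) = a := by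
    intro t
    have ho : IsOpen {q : ℝ × ℝ | (t, q) ∈ Ω} :=
      hΩ.isOpen.preimage (f := fun q : ℝ × ℝ => (t, q)) (by fun_prop)
    exact ho.exists_is_const_of_fderiv_eq_zero (hΩ.sections t)
      (fun q hq => (hF (t, q) hq).differentiableAt.differentiableWithinAt)
      fun q hq => (hF (t, q) hq).fderiv
  choose f hf using h
  exact ⟨f, fun p hp => hf p.1 p.2 hp⟩

theorem contDiffOn_of_eq_comp_fst {Ω : Set Vars} (hΩ : IsOpen Ω) {F : Vars → ℝ}
    (hF : ContDiffOn ℝ ∞ F Ω) {f : ℝ → ℝ} (h : ∀ p ∈ Ω, F p = f p.1) :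
    ContDiffOn ℝ ∞ f (times Ω) := by
  rintro _ ⟨p, hp, rfl⟩
  have hc : ContDiffAt ℝ ∞ (fun t : ℝ => ((t, p.2) : Vars)) p.1 := by fun_prop
  have h1 : ContDiffAt ℝ ∞ (fun t : ℝ => F (t, p.2)) p.1 :=
    ContDiffAt.comp p.1 (g := F) (hF.contDiffAt (hΩ.mem_nhds hp)) hc
  refine (h1.congr_of_eventuallyEq ?_).contDiffWithinAt
  filter_upwards [hc.continuousAt.eventually_mem (hΩ.mem_nhds hp)] with t ht
  exact (h _ ht).symm

theorem hasFDerivAt_section {F : Vars → ℝ} {p : Vars} (hF : DifferentiableAt ℝ F p) :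
    HasFDerivAt (fun q : ℝ × ℝ => F (p.1, q))
      ((fderiv ℝ F p).comp (ContinuousLinearMap.inr ℝ ℝ (ℝ × ℝ))) p.2 :=
  HasFDerivAt.comp p.2 (g := F) hF.hasFDerivAt (hasFDerivAt_prodMk_right p.1 p.2)

theorem hasFDerivAt_section_zero {F : Vars → ℝ} {p : Vars} (hF : DifferentiableAt ℝ F p)
    (hx : fderiv ℝ F p (0, 1, 0) = 0) (hu : fderiv ℝ F p (0, 0, 1) = 0) :
    HasFDerivAt (fun q : ℝ × ℝ => F (p.1, q)) (0 : ℝ × ℝ →L[ℝ] ℝ) p.2 := by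
  have h := hasFDerivAt_section hF
  convert! h using 1
  ext <;> simp [hx, hu]

theorem contDiffOn_fderiv_apply {Ω : Set Vars} (hΩ : IsOpen Ω) {F : Vars → ℝ}
    (hF : ContDiffOn ℝ ∞ F Ω) (e : Vars) : ContDiffOn ℝ ∞ (fun p => fderiv ℝ F p e) Ω :=
  (hF.fderiv_of_isOpen hΩ (by simp)).clm_apply contDiffOn_const

/-! ### Determination of the arbitrary elements by the equation -/

theorem exists_pos_forall_mem {Ω : Set Vars} (hΩ : IsOpen Ω) {t x u : ℝ} (hp : (t, x, u) ∈ Ω) :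
    ∃ r > 0, ∀ y z, |y - x| < r → |z - u| < r → (t, y, z) ∈ Ω := by
  obtain ⟨r, hr, h⟩ := Metric.isOpen_iff.1 hΩ _ hp
  refine ⟨r, hr, fun y z hy hz => h ?_⟩
  simp only [Metric.mem_ball, Prod.dist_eq, Real.dist_eq, sub_self, abs_zero]
  simp [hy, hz]

/-- The first six coefficients of an expansion as a function on `ℕ`. -/
def coeffs (c₀ c₁ c₂ c₃ c₄ c₅ : ℝ) : ℕ → ℝ
  | 0 => c₀
  | 1 => c₁
  | 2 => c₂
  | 3 => c₃
  | 4 => c₄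
  | 5 => c₅
  | _ => 0

theorem jetLhs_add_left (θ : Values) (x : ℝ) (c : ℕ → ℝ) (q : ℝ) :
    jetLhs θ x c q = q + jetLhs θ x c 0 := by
  simp only [jetLhs]; ring

/-- Choosing `u_t` so that the jet satisfies the first equation shows that the two equations
prescribe the same `u_t` for all other jet coordinates. Finitely many test jets then separate the
coefficients. -/
theorem elements_eq_of_lhs_iff {Ω : Set Vars} (hΩ : IsOpen Ω) {θ θ' : Elements} {t : ℝ}
    (ht : t ∈ times Ω) (hθ : θ t ∈ subclassValues) (hθ' : θ' t ∈ subclassValues)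
    (h : ∀ x u, (t, x, u) ∈ Ω → ∀ v : ℝ × ℝ → ℝ, ContDiffAt ℝ ∞ v (t, x) → v (t, x) = u →
      (lhs θ v (t, x) = 0 ↔ lhs θ' v (t, x) = 0)) : θ t = θ' t := by
  have key : ∀ x c₀ c₁ c₂ c₃ c₅, (t, x, c₀) ∈ Ω →
      jetLhs (θ t) x (coeffs c₀ c₁ c₂ c₃ 0 c₅) 0 = jetLhs (θ' t) x (coeffs c₀ c₁ c₂ c₃ 0 c₅) 0 := by
    intro x c₀ c₁ c₂ c₃ c₅ hp
    set c := coeffs c₀ c₁ c₂ c₃ 0 c₅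
    have h1 := h x c₀ hp (jetPoly t x c (-jetLhs (θ t) x c 0)) (contDiff_jetPoly _ _ _ _).contDiffAt
      (jetPoly_self _ _ _ _)
    rw [lhs_jetPoly, lhs_jetPoly, jetLhs_add_left, jetLhs_add_left (θ' t)] at h1
    linarith [h1.1 (by ring)]
  rw [mem_subclassValues_iff] at hθ hθ'
  obtain ⟨⟨t', x, u₀⟩, hp, rfl⟩ := ht
  obtain ⟨r, hr, hball⟩ := exists_pos_forall_mem hΩ hp
  -- `m` and `a` are seen only through multiples of `u`, so `u = 0` must be avoided.
  obtain ⟨u, hu, hur⟩ : ∃ u, u ≠ 0 ∧ |u - u₀| < r / 2 := by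
    by_cases h0 : u₀ = 0
    · refine ⟨r / 4, by positivity, ?_⟩
      rw [h0, sub_zero, abs_of_pos (by positivity)]
      linarith
    · exact ⟨u₀, h0, by simpa using hr⟩
  -- Shifting `x` by `s` separates `k` from `n`. Shifting `u` by `s` separates `c`, with factor `(u
  -- + s)^2 - u^2 = s (2 u + s)`.
  obtain ⟨s, hs, hs2, hsr⟩ : ∃ s, s ≠ 0 ∧ 2 * u + s ≠ 0 ∧ |s| < r / 2 := by
    by_cases h0 : 2 * u + r / 4 = 0
    · exact ⟨r / 3, by positivity, fun h1 => by linarith,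
        by rw [abs_of_pos (by positivity)]; linarith⟩
    · exact ⟨r / 4, by positivity, h0, by rw [abs_of_pos (by positivity)]; linarith⟩
  have m0 : (t', x, u) ∈ Ω := hball _ _ (by simpa) (by linarith)
  have m1 : (t', x + s, u) ∈ Ω := hball _ _ (by simp; linarith) (by linarith)
  have m2 : (t', x, u + s) ∈ Ω := by
    refine hball _ _ (by simpa) ?_
    have := abs_add_le (u - u₀) s
    rw [show u + s - u₀ = u - u₀ + s by ring]
    linarith
  have e0 := key x u 0 0 0 0 m0
  have e5 := key x u 0 0 0 1 m0
  have e3 := key x u 0 0 1 0 m0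
  have e1 := key x u 1 0 0 0 m0
  have e2 := key x u 1 1 0 0 m0
  have e1x := key (x + s) u 1 0 0 0 m1
  have e0u := key x (u + s) 0 0 0 0 m2
  have e1u := key x (u + s) 1 0 0 0 m2
  simp only [jetLhs, coeffs, hθ.2.1, hθ.2.2.1, hθ'.2.1, hθ'.2.2.1] at e0 e5 e3 e1 e2 e1x e0u e1u
  dsimp only at *
  have hm : θ t' .m = θ' t' .m := mul_right_cancel₀ hu (by linarith)
  have hgg : θ t' .g = θ' t' .g := by linarith
  have ha : θ t' .a = θ' t' .a := mul_right_cancel₀ hu (by linarith)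
  have hb : θ t' .b = θ' t' .b := by linarith
  have hk : θ t' .k = θ' t' .k := mul_right_cancel₀ hs (by linarith)
  have hc : θ t' .c = θ' t' .c := by
    refine mul_right_cancel₀ (mul_ne_zero hs hs2) ?_
    rw [hm] at e0u e1u e1
    linarith
  have hn : θ t' .n = θ' t' .n := by
    rw [hm, hk, hc] at e1
    linarith
  ext i
  cases i
  · exact ha
  · exact hb
  · exact hc
  · rw [hθ.2.1, hθ'.2.1]
  · exact hgg
  · rw [hθ.2.2.1, hθ'.2.2.1]
  · exact hm
  · exact hn
  · exact hk

/-! ### Maps `ũ = V(t, x, u)` that fix `t` and `x` -/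

theorem hasDerivAt_line {V : Vars → ℝ} {t y z : ℝ} (hV : DifferentiableAt ℝ V (t, y, z)) :
    HasDerivAt (fun z => V (t, y, z)) (fderiv ℝ V (t, y, z) (0, 0, 1)) z :=
  HasFDerivAt.comp_hasDerivAt z (l := V) hV.hasFDerivAt
    ((hasDerivAt_const z t).prodMk ((hasDerivAt_const z y).prodMk (hasDerivAt_id z)))

theorem exists_sub_eq_fderiv_mul {Ω : Set Vars} {V : Vars → ℝ} (hV : ∀ p ∈ Ω, DifferentiableAt ℝ V p)
    {t y a d : ℝ} (hmem : ∀ z ∈ Set.Icc (0 : ℝ) 1, (t, y, a + z * d) ∈ Ω) :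
    ∃ z ∈ Set.Icc (0 : ℝ) 1,
      V (t, y, a + d) - V (t, y, a) = fderiv ℝ V (t, y, a + z * d) (0, 0, 1) * d := by
  have hd : ∀ z ∈ Set.Icc (0 : ℝ) 1, HasDerivAt (fun z => V (t, y, a + z * d))
      (fderiv ℝ V (t, y, a + z * d) (0, 0, 1) * d) z := by
    intro z hz
    have h1 : HasDerivAt (fun z => a + z * d) d z := by
      simpa using ((hasDerivAt_id z).mul_const d).const_add a
    exact (hasDerivAt_line (hV _ (hmem z hz))).comp z h1
  obtain ⟨z, hz, h⟩ := exists_hasDerivAt_eq_slope _ _ zero_lt_one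
    (fun z hz => (hd z hz).continuousAt.continuousWithinAt)
    fun z hz => hd z (Set.Ioo_subset_Icc_self hz)
  refine ⟨z, Set.Ioo_subset_Icc_self hz, ?_⟩
  simpa using h.symm

/-- By the mean value theorem the difference is `V_u` at an intermediate point times `(y - x)^4`. To
first order `V_u` varies by its total derivative along the graph, which becomes the fifth
coefficient. -/
theorem hasExpansion_sub_of_add_pow_four {Ω : Set Vars} (hΩ : IsOpen Ω) {V : Vars → ℝ}
    (hV : ContDiffOn ℝ ∞ V Ω) {t x : ℝ} {v : ℝ → ℝ} {v₁ : ℝ} (hv : HasDerivAt v v₁ x)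
    (hp : (t, x, v x) ∈ Ω) :
    HasExpansion (fun y => V (t, y, v y + (y - x) ^ 4) - V (t, y, v y)) x
      (coeffs 0 0 0 0 (fderiv ℝ V (t, x, v x) (0, 0, 1))
        (fderiv ℝ (fun p => fderiv ℝ V p (0, 0, 1)) (t, x, v x) (0, 1, v₁))) 5 := by
  obtain ⟨r, hr, hball⟩ := exists_pos_forall_mem hΩ hp
  set κ : Vars → ℝ := fun p => fderiv ℝ V p (0, 0, 1) with hκ
  have hκd : DifferentiableAt ℝ κ (t, x, v x) :=
    ((contDiffOn_fderiv_apply hΩ hV (0, 0, 1)).contDiffAt (hΩ.mem_nhds hp)).differentiableAt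
      (by simp)
  have hpow : Tendsto (fun y : ℝ => (y - x) ^ 4) (𝓝 x) (𝓝 0) := by
    have : Tendsto (fun y : ℝ => (y - x) ^ 4) (𝓝 x) (𝓝 ((x - x) ^ 4)) :=
      Continuous.tendsto (by fun_prop) x
    simpa using this
  have hex : ∀ᶠ y in 𝓝 x, ∃ z ∈ Set.Icc (0 : ℝ) 1,
      V (t, y, v y + (y - x) ^ 4) - V (t, y, v y)
        = κ (t, y, v y + z * (y - x) ^ 4) * (y - x) ^ 4 := by
    filter_upwards [Metric.ball_mem_nhds x hr,
      hv.continuousAt.eventually_mem (Metric.ball_mem_nhds _ (half_pos hr)),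
      hpow.eventually_mem (Metric.ball_mem_nhds _ (half_pos hr))] with y h1 h2 h3
    rw [Metric.mem_ball, Real.dist_eq] at h1 h2 h3
    refine exists_sub_eq_fderiv_mul (Ω := Ω)
      (fun p hp => (hV.contDiffAt (hΩ.mem_nhds hp)).differentiableAt (by simp)) fun z hz => ?_
    refine hball _ _ h1 ?_
    have h4 : |z * (y - x) ^ 4| ≤ |(y - x) ^ 4| := by
      rw [abs_mul, abs_of_nonneg hz.1]
      exact mul_le_of_le_one_left (abs_nonneg _) hz.2
    have h5 := abs_add_le (v y - v x) (z * (y - x) ^ 4)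
    rw [sub_zero] at h3
    rw [show v y + z * (y - x) ^ 4 - v x = v y - v x + z * (y - x) ^ 4 by ring]
    linarith
  obtain ⟨ζ, hζ⟩ := hex.choice
  -- The intermediate parameter `ζ` need not be continuous. It is bounded by `1`, so the
  -- displacement is still of fourth order.
  have hsmall : HasDerivAt (fun y => ζ y * (y - x) ^ 4) 0 x := by
    rw [hasDerivAt_iff_isLittleO]
    have h1 : (fun y => ζ y * (y - x) ^ 4) =O[𝓝 x] fun y => (y - x) ^ 4 := by
      refine IsBigO.of_bound 1 ?_
      filter_upwards [hζ] with y hy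
      rw [one_mul, norm_mul, Real.norm_eq_abs, abs_of_nonneg hy.1.1]
      exact mul_le_of_le_one_left (norm_nonneg _) hy.1.2
    have h2 := h1.trans_isLittleO (isLittleO_pow_sub (x := x) (m := 1) (n := 4) (by norm_num))
    simpa using h2
  have hcurve : HasDerivAt (fun y => κ (t, y, v y + ζ y * (y - x) ^ 4))
      (fderiv ℝ κ (t, x, v x) (0, 1, v₁)) x := by
    have h1 := (hasDerivAt_const x t).prodMk ((hasDerivAt_id x).prodMk (hv.add hsmall))
    rw [add_zero] at h1
    refine HasFDerivAt.comp_hasDerivAt x (l := κ) ?_ h1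
    simpa using hκd.hasFDerivAt
  have hlo := (hcurve.isLittleO).mul_isBigO (isBigO_refl (fun y : ℝ => (y - x) ^ 4) (𝓝 x))
  refine IsLittleO.congr' hlo ?_ (Eventually.of_forall fun y => by ring)
  filter_upwards [hζ] with y hy
  rw [hy.2]
  simp [Finset.sum_range_succ, coeffs]
  ring

theorem contDiffAt_graph {Ω : Set Vars} (hΩ : IsOpen Ω) {V : Vars → ℝ}
    (hV : ContDiffOn ℝ ∞ V Ω) {t x : ℝ} {v : ℝ × ℝ → ℝ} (hp : (t, x, v (t, x)) ∈ Ω)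
    (hv : ContDiffAt ℝ ∞ v (t, x)) :
    ContDiffAt ℝ ∞ (fun r : ℝ × ℝ => V (r.1, r.2, v r)) (t, x) :=
  ContDiffAt.comp (t, x) (g := V) (f := fun r : ℝ × ℝ => (r.1, r.2, v r))
    (hV.contDiffAt (hΩ.mem_nhds hp)) (contDiffAt_fst.prodMk (contDiffAt_snd.prodMk hv))

/-- The fiber-preserving transformation `ũ = V(t, x, u)` maps the equation with arbitrary elements
`θ` to the one with `θ'`. -/
def MapsByFiber (Ω : Set Vars) (V : Vars → ℝ) (θ θ' : Elements) : Prop :=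
  ∀ t x u : ℝ, (t, x, u) ∈ Ω → ∀ v : ℝ × ℝ → ℝ, ContDiffAt ℝ ∞ v (t, x) → v (t, x) = u →
    (lhs θ v (t, x) = 0 ↔ lhs θ' (fun r => V (r.1, r.2, v r)) (t, x) = 0)

/-- The fourth derivative is absent from both equations. Adding a quartic term to a solution jet
therefore keeps it a solution, while the image changes in `u_xxxxx` by a multiple of `D_x V_u`. As
`g ≠ 0` in the target, `D_x V_u` vanishes for every value `v₁` of `u_x`. -/
theorem MapsByFiber.fderiv_fderiv_eq_zero {Ω : Set Vars} (hΩ : IsOpen Ω) {V : Vars → ℝ}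
    (hV : ContDiffOn ℝ ∞ V Ω) {θ θ' : Elements} (h : MapsByFiber Ω V θ θ') {t x u : ℝ}
    (hp : (t, x, u) ∈ Ω) (hg : θ' t .g ≠ 0) (v₁ : ℝ) :
    fderiv ℝ (fun p => fderiv ℝ V p (0, 0, 1)) (t, x, u) (0, 1, v₁) = 0 := by
  set c : ℕ → ℝ := coeffs u v₁ 0 0 0 0 with hc
  set c' : ℕ → ℝ := coeffs u v₁ 0 0 1 0 with hc'
  set q := -jetLhs (θ t) x c 0 with hq
  set v := jetPoly t x c q
  set v' := jetPoly t x c' q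
  have hv0 : v (t, x) = u := jetPoly_self _ _ _ _
  have hv0' : v' (t, x) = u := jetPoly_self _ _ _ _
  have hvs : ContDiffAt ℝ ∞ v (t, x) := (contDiff_jetPoly _ _ _ _).contDiffAt
  have hvs' : ContDiffAt ℝ ∞ v' (t, x) := (contDiff_jetPoly _ _ _ _).contDiffAt
  have hl : lhs θ v (t, x) = 0 := by
    rw [lhs_jetPoly, jetLhs_add_left, hq]
    ring
  have hl' : lhs θ v' (t, x) = 0 := by
    rw [lhs_jetPoly, ← hl, lhs_jetPoly]
    rfl
  have hvv' : ∀ r : ℝ × ℝ, v' r = v r + (r.2 - x) ^ 4 := fun r => by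
    simp only [v, v', jetPoly, Finset.sum_range_succ, hc, hc', coeffs]
    ring
  have hW := contDiffAt_graph hΩ hV (by rwa [hv0]) hvs
  have hW' := contDiffAt_graph hΩ hV (by rwa [hv0']) hvs'
  obtain ⟨d, Q, -, hd, -, hQ⟩ := exists_lhs_eq_jetLhs hW
  have hE := hasExpansion_sub_of_add_pow_four hΩ hV (v := fun y => v (t, y))
    (hasDerivAt_jetPoly_right t x c q) (by rwa [hv0])
  have hd' : HasExpansion (fun y => V (t, y, v' (t, y))) x _ 5 := (hd.add hE).congr (by
    filter_upwards with y
    rw [hvv']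
    ring)
  have hQ' : HasDerivAt (fun s => V (s, x, v' (s, x))) Q t := by
    simpa only [hvv', sub_self, ne_eq, OfNat.ofNat_ne_zero, not_false_eq_true, zero_pow, add_zero]
      using hQ
  have e := (h t x u hp v hvs hv0).1 hl
  have e' := (h t x u hp v' hvs' hv0').1 hl'
  rw [lhs_eq_jetLhs hW hd hQ] at e
  rw [lhs_eq_jetLhs hW' hd' hQ'] at e'
  rw [hv0] at e'
  have : θ' t .g * fderiv ℝ (fun p => fderiv ℝ V p (0, 0, 1)) (t, x, u) (0, 1, c 1) = 0 := by
    simp only [jetLhs, coeffs, add_zero] at e e'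
    linarith
  exact (mul_eq_zero.1 this).resolve_left hg

/-- Since `V` is affine in `u` with slope `φ`, the image jet is the jet `d` of `V(t, ·, u)` plus `φ`
times the jet of `v - u`, whence the zero at index `0`. Eliminating `u_t` by the source equation
leaves an identity in free jet coordinates. -/
theorem MapsByFiber.jetLhs_eq {Ω : Set Vars} (hΩ : IsOpen Ω) {V : Vars → ℝ}
    (hV : ContDiffOn ℝ ∞ V Ω) {θ θ' : Elements} (h : MapsByFiber Ω V θ θ') {φ : ℝ → ℝ}
    (hφ : ∀ p ∈ Ω, fderiv ℝ V p (0, 0, 1) = φ p.1) {t x u : ℝ} (hp : (t, x, u) ∈ Ω) {d : ℕ → ℝ}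
    (hd : HasExpansion (fun y => V (t, y, u)) x d 5) {c : ℕ → ℝ} (hc : c 0 = u) :
    jetLhs (θ' t) x (fun k => d k + φ t * if k = 0 then 0 else c k)
      (fderiv ℝ V (t, x, u) (1, 0, 0)) = φ t * jetLhs (θ t) x c 0 := by
  set q := -jetLhs (θ t) x c 0 with hq
  set v := jetPoly t x c q
  have hv0 : v (t, x) = u := by rw [← hc]; exact jetPoly_self _ _ _ _
  have hvs : ContDiffAt ℝ ∞ v (t, x) := (contDiff_jetPoly _ _ _ _).contDiffAt
  have hl : lhs θ v (t, x) = 0 := by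
    rw [lhs_jetPoly, jetLhs_add_left, hq]
    ring
  have hVd : ∀ p ∈ Ω, DifferentiableAt ℝ V p :=
    fun p hp => (hV.contDiffAt (hΩ.mem_nhds hp)).differentiableAt (by simp)
  have hW := contDiffAt_graph hΩ hV (by rwa [hv0]) hvs
  have hQ : HasDerivAt (fun s => V (s, x, v (s, x))) (fderiv ℝ V (t, x, u) (1, 0, 0) + φ t * q) t := by
    have h1 := (hasDerivAt_id t).prodMk
      ((hasDerivAt_const t x).prodMk (hasDerivAt_jetPoly_left t x c q))
    have h2 := HasFDerivAt.comp_hasDerivAt t (l := V) (by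
      rw [show jetPoly t x c q (t, x) = u from hv0]
      exact (hVd _ hp).hasFDerivAt) h1
    convert! h2 using 1
    rw [show ((1, 0, q) : Vars) = (1, 0, 0) + q • (0, 0, 1) by simp, map_add, map_smul,
      hφ _ hp, smul_eq_mul, mul_comm]
  have hD : HasExpansion (fun y => V (t, y, v (t, y))) x
      (fun k => d k + φ t * if k = 0 then 0 else c k) 5 := by
    have h1 : HasExpansion (fun y => v (t, y) - u) x (fun k => if k = 0 then 0 else c k) 5 :=
      .of_eq fun y => by
        simp [v, jetPoly, Finset.sum_range_succ, hc]
        ring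
    refine (hd.add (h1.const_mul (φ t))).congr ?_
    obtain ⟨r, hr, hball⟩ := exists_pos_forall_mem hΩ hp
    have hcont : ContinuousAt (fun y => v (t, y)) x := (hasDerivAt_jetPoly_right t x c q).continuousAt
    filter_upwards [Metric.ball_mem_nhds x hr,
      hcont.eventually_mem (Metric.ball_mem_nhds _ hr)] with y h2 h3
    rw [Metric.mem_ball, Real.dist_eq] at h2 h3
    rw [hv0] at h3
    obtain ⟨z, hz, h4⟩ := exists_sub_eq_fderiv_mul hVd (t := t) (y := y) (a := u) (d := v (t, y) - u)
      fun z hz => by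
        refine hball _ _ h2 ?_
        rw [add_sub_cancel_left, abs_mul, abs_of_nonneg hz.1]
        exact (mul_le_of_le_one_left (abs_nonneg _) hz.2).trans_lt h3
    rw [hφ] at h4
    · rw [add_sub_cancel] at h4
      linarith
    · refine hball _ _ h2 ?_
      rw [add_sub_cancel_left, abs_mul, abs_of_nonneg hz.1]
      exact (mul_le_of_le_one_left (abs_nonneg _) hz.2).trans_lt h3
  have e := (h t x u hp v hvs hv0).1 hl
  rw [lhs_eq_jetLhs hW hD hQ, jetLhs_add_left] at e
  rw [jetLhs_add_left]
  rw [hq] at e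
  linarith

/-- Equating the factors of `u_xxx` and of `u_x` gives, in `u` and `V`, `a' V = a u` and `c' V^2 = c
u^2` up to terms free of `u`. Nonzero `f` or `h` could absorb a shift of `u`; without them either
`a' ≠ 0` or `c' ≠ 0` excludes a free term in `V`. -/
theorem MapsByFiber.eq_mul {Ω : Set Vars} (hΩ : IsOpen Ω) {V : Vars → ℝ}
    (hV : ContDiffOn ℝ ∞ V Ω) {θ θ' : Elements} (h : MapsByFiber Ω V θ θ') {φ : ℝ → ℝ}
    (hφ : ∀ p ∈ Ω, fderiv ℝ V p (0, 0, 1) = φ p.1) {t x u : ℝ} (hp : (t, x, u) ∈ Ω)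
    (hθ : θ t ∈ subclassValues) (hθ' : θ' t ∈ subclassValues) (hφ0 : φ t ≠ 0) :
    V (t, x, u) = φ t * u := by
  have hVd : ∀ p ∈ Ω, DifferentiableAt ℝ V p :=
    fun p hp => (hV.contDiffAt (hΩ.mem_nhds hp)).differentiableAt (by simp)
  rw [mem_subclassValues_iff] at hθ hθ'
  obtain ⟨r, hr, hball⟩ := exists_pos_forall_mem hΩ hp
  have hs : ContDiffAt ℝ (5 : ℕ) (fun y => V (t, y, u)) x := by
    have h1 : ContDiffAt ℝ ∞ (fun y => V (t, y, u)) x :=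
      ContDiffAt.comp x (g := V) (f := fun y : ℝ => ((t, y, u) : Vars))
        (hV.contDiffAt (hΩ.mem_nhds hp)) (by fun_prop)
    exact contDiffAt_infty.1 h1 5
  obtain ⟨d, hd0, hd⟩ : ∃ d : ℕ → ℝ, d 0 = V (t, x, u) ∧
      HasExpansion (fun y => V (t, y, u)) x d 5 := ⟨_, by simp, hs.hasExpansion⟩
  have haff : ∀ s, |s| < r → ∀ y, |y - x| < r → V (t, y, u + s) = V (t, y, u) + φ t * s := by
    intro s hs y hy
    have hm : ∀ z ∈ Set.Icc (0 : ℝ) 1, (t, y, u + z * s) ∈ Ω := fun z hz => by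
      refine hball _ _ hy ?_
      rw [add_sub_cancel_left, abs_mul, abs_of_nonneg hz.1]
      exact (mul_le_of_le_one_left (abs_nonneg _) hz.2).trans_lt hs
    obtain ⟨z, hz, h4⟩ := exists_sub_eq_fderiv_mul hVd hm
    rw [hφ _ (hm z hz)] at h4
    linarith
  have key : ∀ s, |s| < r →
      θ' t .a * (d 0 + φ t * s) = θ t .a * (u + s) ∧
      2 * θ' t .b * d 2 + θ' t .c * (d 0 + φ t * s) ^ 2 + θ' t .n + θ' t .k * x
        = θ t .c * (u + s) ^ 2 + θ t .n + θ t .k * x := by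
    intro s hs
    have hps : (t, x, u + s) ∈ Ω := hball _ _ (by simpa) (by simpa)
    have hds : HasExpansion (fun y => V (t, y, u + s)) x
        (fun k => d k + if k = 0 then φ t * s else 0) 5 := by
      have h1 : HasExpansion (fun _ : ℝ => φ t * s) x (fun k => if k = 0 then φ t * s else 0) 5 :=
        .of_eq fun y => by simp
      refine (hd.add h1).congr ?_
      filter_upwards [Metric.ball_mem_nhds x hr] with y hy
      rw [Metric.mem_ball, Real.dist_eq] at hy
      exact (haff s hs y hy).symm
    have e0 := h.jetLhs_eq hΩ hV hφ hps hds (c := coeffs (u + s) 0 0 0 0 0) rfl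
    have e1 := h.jetLhs_eq hΩ hV hφ hps hds (c := coeffs (u + s) 1 0 0 0 0) rfl
    have e3 := h.jetLhs_eq hΩ hV hφ hps hds (c := coeffs (u + s) 0 0 1 0 0) rfl
    simp [jetLhs, coeffs, hθ.2.1, hθ.2.2.1, hθ'.2.1, hθ'.2.2.1] at e0 e1 e3
    constructor
    · refine mul_left_cancel₀ hφ0 ?_
      linarith
    · refine mul_left_cancel₀ hφ0 ?_
      linarith
  -- Three values of `s` suffice to compare polynomials in `s` of degree at most two.
  have k0 := key 0 (by simpa)
  have k1 := key (r / 2) (by rw [abs_of_pos (by positivity)]; linarith)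
  have k2 := key (-(r / 2)) (by rw [abs_neg, abs_of_pos (by positivity)]; linarith)
  rw [← hd0]
  rcases hθ'.2.2.2 with ha | hc
  · have h1 : θ' t .a * φ t = θ t .a := mul_right_cancel₀ (half_pos hr).ne' (by linarith [k0.1, k1.1])
    refine mul_left_cancel₀ ha ?_
    rw [← mul_assoc, h1]
    linarith [k0.1]
  · have h1 : θ' t .c * φ t ^ 2 = θ t .c :=
      mul_right_cancel₀ (pow_ne_zero 2 (half_pos hr).ne') (by linarith [k0.2, k1.2, k2.2])
    have h2 : θ' t .c * φ t * d 0 = θ t .c * u :=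
      mul_right_cancel₀ (half_pos hr).ne' (by linarith [k0.2, k1.2, k2.2])
    refine mul_left_cancel₀ (mul_ne_zero hc hφ0) ?_
    rw [h2, ← h1]
    ring

/-! ### Functions whose graphs are mapped to given ones, and their perturbations -/

/-- The function of `(t, x, u)` whose vanishing means that the point is mapped to the graph of `w`. -/
def defect (T X U : Vars → ℝ) (w : ℝ × ℝ → ℝ) (p : Vars) : ℝ := U p - w (T p, X p)

theorem contDiffAt_defect {T X U : Vars → ℝ} {w : ℝ × ℝ → ℝ} {p : Vars} (hT : ContDiffAt ℝ ∞ T p)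
    (hX : ContDiffAt ℝ ∞ X p) (hU : ContDiffAt ℝ ∞ U p) (hw : ContDiffAt ℝ ∞ w (T p, X p)) :
    ContDiffAt ℝ ∞ (defect T X U w) p :=
  hU.sub (ContDiffAt.comp p (g := w) (f := fun p => (T p, X p)) hw (hT.prodMk hX))

theorem exists_implicit_graph {G : Vars → ℝ} {t x u : ℝ} (hG : ContDiffAt ℝ ∞ G (t, x, u))
    (h0 : G (t, x, u) = 0) (hne : fderiv ℝ G (t, x, u) (0, 0, 1) ≠ 0) :
    ∃ v : ℝ × ℝ → ℝ, ContDiffAt ℝ ∞ v (t, x) ∧ v (t, x) = u ∧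
      ∀ᶠ r in 𝓝 (t, x), G (r.1, r.2, v r) = 0 := by
  let f : (ℝ × ℝ) × ℝ → ℝ := fun z => G (z.1.1, z.1.2, z.2)
  have hf : ContDiffAt ℝ ∞ f ((t, x), u) :=
    ContDiffAt.comp ((t, x), u) (g := G) (f := fun z : (ℝ × ℝ) × ℝ => (z.1.1, z.1.2, z.2)) hG
      (by fun_prop)
  have hinv : (fderiv ℝ f ((t, x), u) ∘L .inr ℝ (ℝ × ℝ) ℝ).IsInvertible := by
    have h1 : (fderiv ℝ f ((t, x), u)) ((0 : ℝ × ℝ), (1 : ℝ)) = fderiv ℝ G (t, x, u) (0, 0, 1) := by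
      have hc : HasDerivAt (fun z : ℝ => (((t, x), z) : (ℝ × ℝ) × ℝ)) ((0 : ℝ × ℝ), (1 : ℝ)) u :=
        (hasDerivAt_const u (t, x)).prodMk (hasDerivAt_id u)
      have h2 := HasFDerivAt.comp_hasDerivAt u (l := f)
        (hf.differentiableAt (by simp)).hasFDerivAt hc
      exact h2.unique (hasDerivAt_line (hG.differentiableAt (by simp)))
    refine ⟨ContinuousLinearEquiv.unitsEquivAut ℝ (Units.mk0 _ hne), ?_⟩
    ext
    simpa using h1.symm
  refine ⟨hf.implicitFunction (by simp) hinv, hf.contDiffAt_implicitFunction (by simp) hinv,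
    hf.implicitFunction_apply_self (by simp) hinv, ?_⟩
  filter_upwards [hf.eventually_apply_implicitFunction (by simp) hinv] with r hr
  exact hr.trans h0

/-- The points on the two graphs differ only in `u`, so strict differentiability gives `E = G_u (v'
- v) + o(v' - v)`. Dividing by `G_u` transfers the leading term of `E` to `v' - v`. -/
theorem isLittleO_sub_of_implicit {G : Vars → ℝ} {t x u : ℝ} (hG : ContDiffAt ℝ ∞ G (t, x, u))
    (hne : fderiv ℝ G (t, x, u) (0, 0, 1) ≠ 0) {v v' E : ℝ × ℝ → ℝ} (hv : ContinuousAt v (t, x))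
    (hv' : ContinuousAt v' (t, x)) (hu : v (t, x) = u) (hu' : v' (t, x) = u)
    (h : ∀ᶠ r in 𝓝 (t, x), G (r.1, r.2, v r) = 0)
    (h' : ∀ᶠ r in 𝓝 (t, x), G (r.1, r.2, v' r) = E r) {ρ : ℝ → ℝ × ℝ} {s e : ℝ} {n : ℕ}
    (hρ : Tendsto ρ (𝓝 s) (𝓝 (t, x)))
    (hE : (fun y => E (ρ y) - e * (y - s) ^ n) =o[𝓝 s] fun y => (y - s) ^ n) :
    (fun y => v' (ρ y) - v (ρ y) - e / fderiv ℝ G (t, x, u) (0, 0, 1) * (y - s) ^ n) =o[𝓝 s]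
      fun y => (y - s) ^ n := by
  set L := fderiv ℝ G (t, x, u) with hL
  set κ := L (0, 0, 1) with hκ
  have hstrict : HasStrictFDerivAt G L (t, x, u) := hG.hasStrictFDerivAt (by simp)
  have c1 : Tendsto (fun r : ℝ × ℝ => ((r.1, r.2, v' r) : Vars)) (𝓝 (t, x)) (𝓝 (t, x, u)) := by
    have : ContinuousAt (fun r : ℝ × ℝ => ((r.1, r.2, v' r) : Vars)) (t, x) := by fun_prop
    simpa [ContinuousAt, hu'] using this
  have c2 : Tendsto (fun r : ℝ × ℝ => ((r.1, r.2, v r) : Vars)) (𝓝 (t, x)) (𝓝 (t, x, u)) := by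
    have : ContinuousAt (fun r : ℝ × ℝ => ((r.1, r.2, v r) : Vars)) (t, x) := by fun_prop
    simpa [ContinuousAt, hu] using this
  have h1 := hstrict.isLittleO.comp_tendsto ((c1.prodMk_nhds c2).comp hρ)
  have h2 : (fun y => κ * (v' (ρ y) - v (ρ y)) - E (ρ y)) =o[𝓝 s]
      fun y => κ * (v' (ρ y) - v (ρ y)) := by
    have h3 : (fun y => E (ρ y) - κ * (v' (ρ y) - v (ρ y))) =o[𝓝 s]
        fun y => v' (ρ y) - v (ρ y) := by
      have hO : ((fun p : Vars × Vars => p.1 - p.2) ∘ (fun c : ℝ × ℝ =>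
          (((c.1, c.2, v' c), c.1, c.2, v c) : Vars × Vars)) ∘ ρ) =O[𝓝 s]
          fun y => v' (ρ y) - v (ρ y) := by
        refine IsBigO.of_bound 1 (Eventually.of_forall fun y => ?_)
        simp [Prod.norm_def]
      refine (h1.trans_isBigO hO).congr' ?_ EventuallyEq.rfl
      · filter_upwards [hρ.eventually h, hρ.eventually h'] with y hy hy'
        simp only [Function.comp_apply, hy, hy']
        have : (((ρ y).1, (ρ y).2, v' (ρ y)) : Vars) - ((ρ y).1, (ρ y).2, v (ρ y))
            = (v' (ρ y) - v (ρ y)) • (0, 0, 1) := by simp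
        rw [this, map_smul, smul_eq_mul, ← hκ]
        ring
    refine (h3.neg_left.trans_isBigO (isBigO_self_const_mul hne _ _)).congr_left fun y => ?_
    ring
  have h4 : (fun y => κ * (v' (ρ y) - v (ρ y))) =O[𝓝 s] fun y => (y - s) ^ n := by
    have h5 : (fun y => κ * (v' (ρ y) - v (ρ y))) =O[𝓝 s] fun y => E (ρ y) :=
      h2.right_isBigO_sub.congr_right fun y => by ring
    refine h5.trans ?_
    have h6 : (fun y => e * (y - s) ^ n) =O[𝓝 s] fun y => (y - s) ^ n :=
      (isBigO_refl _ _).const_mul_left e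
    exact (hE.isBigO.add h6).congr_left fun y => by ring
  have h7 := ((h2.trans_isBigO h4).add hE).const_mul_left κ⁻¹
  refine h7.congr_left fun y => ?_
  field_simp
  ring

theorem HasDerivAt.isLittleO_pow_five {f : ℝ → ℝ} {D s : ℝ} (hf : HasDerivAt f D s) :
    (fun y => (f y - f s) ^ 5 - D ^ 5 * (y - s) ^ 5) =o[𝓝 s] fun y => (y - s) ^ 5 := by
  have h0 : (fun y => f y - f s - D * (y - s)) =o[𝓝 s] fun y => y - s := by
    refine hf.isLittleO.congr_left fun y => ?_
    simp [mul_comm]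
  have hb : (fun y => D * (y - s)) =O[𝓝 s] fun y => y - s := (isBigO_refl _ _).const_mul_left D
  have ha : (fun y => f y - f s) =O[𝓝 s] fun y => y - s :=
    (h0.isBigO.add hb).congr_left fun y => by ring
  -- The cofactor in the factorization of `a^5 - b^5` by `a - b`.
  have hS : (fun y => (f y - f s) ^ 4 + (f y - f s) ^ 3 * (D * (y - s))
      + (f y - f s) ^ 2 * (D * (y - s)) ^ 2 + (f y - f s) * (D * (y - s)) ^ 3
      + (D * (y - s)) ^ 4) =O[𝓝 s] fun y => (y - s) ^ 4 := by
    refine ((((ha.pow 4).add (((ha.pow 3).mul hb).congr_right fun y => by ring)).add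
      (((ha.pow 2).mul (hb.pow 2)).congr_right fun y => by ring)).add
      ((ha.mul (hb.pow 3)).congr_right fun y => by ring)).add (hb.pow 4)
  exact (h0.mul_isBigO hS).congr (fun y => by ring) fun y => by ring

theorem hasDerivAt_graph_right {F : Vars → ℝ} {t x u : ℝ} (hF : DifferentiableAt ℝ F (t, x, u))
    {v : ℝ × ℝ → ℝ} (hu : v (t, x) = u) {ζ : ℝ} (hv : HasDerivAt (fun y => v (t, y)) ζ x) :
    HasDerivAt (fun y => F (t, y, v (t, y)))
      (fderiv ℝ F (t, x, u) (0, 1, 0) + fderiv ℝ F (t, x, u) (0, 0, 1) * ζ) x := by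
  have h1 := (hasDerivAt_const x t).prodMk ((hasDerivAt_id x).prodMk hv)
  have h2 := HasFDerivAt.comp_hasDerivAt x (l := F) (by rw [hu]; exact hF.hasFDerivAt) h1
  convert! h2 using 1
  rw [show ((0, 1, ζ) : Vars) = (0, 1, 0) + ζ • (0, 0, 1) by simp, map_add, map_smul, smul_eq_mul,
    mul_comm]

theorem hasDerivAt_graph_left {F : Vars → ℝ} {t x u : ℝ} (hF : DifferentiableAt ℝ F (t, x, u))
    {v : ℝ × ℝ → ℝ} (hu : v (t, x) = u) {ζ : ℝ} (hv : HasDerivAt (fun s => v (s, x)) ζ t) :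
    HasDerivAt (fun s => F (s, x, v (s, x)))
      (fderiv ℝ F (t, x, u) (1, 0, 0) + fderiv ℝ F (t, x, u) (0, 0, 1) * ζ) t := by
  have h1 := (hasDerivAt_id t).prodMk ((hasDerivAt_const t x).prodMk hv)
  have h2 := HasFDerivAt.comp_hasDerivAt t (l := F) (by rw [hu]; exact hF.hasFDerivAt) h1
  convert! h2 using 1
  rw [show ((1, 0, ζ) : Vars) = (1, 0, 0) + ζ • (0, 0, 1) by simp, map_add, map_smul, smul_eq_mul,
    mul_comm]

/-- `jetPoly` perturbed by a term that is invisible for the equation. -/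
def jetPolyAdd (t x : ℝ) (c : ℕ → ℝ) (q a : ℝ) (r : ℝ × ℝ) : ℝ :=
  jetPoly t x c q r + a * (r.1 - t) ^ 5

theorem contDiff_jetPolyAdd (t x : ℝ) (c : ℕ → ℝ) (q a : ℝ) {n : ℕ∞ω} :
    ContDiff ℝ n (jetPolyAdd t x c q a) := by
  have := contDiff_jetPoly t x c q (n := n)
  unfold jetPolyAdd; fun_prop

theorem jetPolyAdd_self (t x : ℝ) (c : ℕ → ℝ) (q a : ℝ) : jetPolyAdd t x c q a (t, x) = c 0 := by
  simp [jetPolyAdd, jetPoly_self]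

theorem hasDerivAt_jetPolyAdd_left (t x : ℝ) (c : ℕ → ℝ) (q a : ℝ) :
    HasDerivAt (fun s => jetPolyAdd t x c q a (s, x)) q t := by
  have h := (hasDerivAt_jetPoly_left t x c q).add
    ((((hasDerivAt_id t).sub_const t).pow 5).const_mul a)
  convert! h using 1
  simp

theorem jetPolyAdd_right (t x : ℝ) (c : ℕ → ℝ) (q a y : ℝ) :
    jetPolyAdd t x c q a (t, y) = jetPoly t x c q (t, y) := by
  simp [jetPolyAdd]

theorem lhs_jetPolyAdd (θ : Elements) (t x : ℝ) (c : ℕ → ℝ) (q a : ℝ) :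
    lhs θ (jetPolyAdd t x c q a) (t, x) = jetLhs (θ t) x c q := by
  refine lhs_eq_jetLhs (contDiff_jetPolyAdd t x c q a).contDiffAt ?_
    (hasDerivAt_jetPolyAdd_left t x c q a)
  simpa only [jetPolyAdd_right] using hasExpansion_jetPoly t x c q

theorem fderiv_defect_jetPolyAdd {T X U : Vars → ℝ} {p : Vars} (hT : DifferentiableAt ℝ T p)
    (hX : DifferentiableAt ℝ X p) (hU : DifferentiableAt ℝ U p) (c : ℕ → ℝ) (q a : ℝ) (z : Vars) :
    fderiv ℝ (defect T X U (jetPolyAdd (T p) (X p) c q a)) p z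
      = fderiv ℝ U p z - (q * fderiv ℝ T p z + c 1 * fderiv ℝ X p z) := by
  set w := jetPolyAdd (T p) (X p) c q a with hw
  have hwd : DifferentiableAt ℝ w (T p, X p) :=
    (contDiff_jetPolyAdd (n := 1) _ _ _ _ _).contDiffAt.differentiableAt (by simp)
  have e1 := deriv_fst_of_differentiableAt hwd
  have e2 := deriv_snd_of_differentiableAt hwd
  simp only [hw, jetPolyAdd_right, (hasDerivAt_jetPolyAdd_left _ _ _ _ _).deriv,
    (hasDerivAt_jetPoly_right _ _ _ _).deriv] at e1 e2
  have h := hU.hasFDerivAt.sub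
    (HasFDerivAt.comp p (g := w) hwd.hasFDerivAt (hT.hasFDerivAt.prodMk hX.hasFDerivAt))
  have h' : HasFDerivAt (defect T X U w) _ p := h
  rw [h'.fderiv]
  have hz : ((fderiv ℝ T p z, fderiv ℝ X p z) : ℝ × ℝ)
      = fderiv ℝ T p z • (1, 0) + fderiv ℝ X p z • (0, 1) := by simp
  simp only [sub_apply, ContinuousLinearMap.comp_apply, ContinuousLinearMap.prod_apply]
  rw [hz, map_add, map_smul, map_smul, ← e1, ← e2]
  simp only [smul_eq_mul]
  ring

/-- `w'` is `w` plus `δ (t̃ - T) + b (x̃ - X)^5 + a (t̃ - T)^5`, with `T` and `X` taken at the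
point. The relation between `δ` and `b` keeps it on the target equation. The implicit function
theorem pulls both back, `hκ` being the transversality condition. At the point the pullbacks `v`,
`v'` differ, among the derivatives in the equation, only in `u_xxxxx` and `u_t`; subtracting their
equations gives the second conclusion, where `ζ` is the slope of `v'` in `x`. -/
theorem MapsEquation.perturbation {Ω : Set Vars} (hΩ : IsOpen Ω) {T X U : Vars → ℝ}
    (hT : ContDiffOn ℝ ∞ T Ω) (hX : ContDiffOn ℝ ∞ X Ω) (hU : ContDiffOn ℝ ∞ U Ω)
    {θ θ' : Elements} (h : MapsEquation Ω (fun p => (T p, X p, U p)) θ θ') {t x u : ℝ}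
    (hp : (t, x, u) ∈ Ω) {c : ℕ → ℝ} {q a b δ : ℝ} (hc0 : c 0 = U (t, x, u))
    (hl : jetLhs (θ' (T (t, x, u))) (X (t, x, u)) c q = 0)
    (hδ : δ + 120 * θ' (T (t, x, u)) .g * b = 0)
    (hδx : δ * fderiv ℝ T (t, x, u) (0, 1, 0) = 0) (hδu : δ * fderiv ℝ T (t, x, u) (0, 0, 1) = 0)
    (hδT : δ = 0 ∨ ∀ y z, (t, y, z) ∈ Ω → T (t, y, z) = T (t, x, u))
    (hκ : fderiv ℝ U (t, x, u) (0, 0, 1) - (q * fderiv ℝ T (t, x, u) (0, 0, 1)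
      + c 1 * fderiv ℝ X (t, x, u) (0, 0, 1)) ≠ 0) :
    ∃ ζ : ℝ, (fderiv ℝ U (t, x, u) (0, 0, 1) - (q * fderiv ℝ T (t, x, u) (0, 0, 1)
        + c 1 * fderiv ℝ X (t, x, u) (0, 0, 1))) * ζ
          = -(fderiv ℝ U (t, x, u) (0, 1, 0) - (q * fderiv ℝ T (t, x, u) (0, 1, 0)
        + c 1 * fderiv ℝ X (t, x, u) (0, 1, 0))) ∧
      120 * θ t .g * (a * (fderiv ℝ T (t, x, u) (0, 1, 0) + fderiv ℝ T (t, x, u) (0, 0, 1) * ζ) ^ 5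
        + b * (fderiv ℝ X (t, x, u) (0, 1, 0) + fderiv ℝ X (t, x, u) (0, 0, 1) * ζ) ^ 5)
        + δ * fderiv ℝ T (t, x, u) (1, 0, 0) = 0 := by
  set p : Vars := (t, x, u) with hpdef
  have hTp := hT.contDiffAt (hΩ.mem_nhds hp)
  have hXp := hX.contDiffAt (hΩ.mem_nhds hp)
  have hUp := hU.contDiffAt (hΩ.mem_nhds hp)
  have dT := hTp.differentiableAt (by simp)
  have dX := hXp.differentiableAt (by simp)
  have dU := hUp.differentiableAt (by simp)
  set c' : ℕ → ℝ := fun k => c k + if k = 5 then b else 0 with hc'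
  set w := jetPolyAdd (T p) (X p) c q 0 with hw
  set w' := jetPolyAdd (T p) (X p) c' (q + δ) a with hw'
  have hws : ContDiffAt ℝ ∞ w (T p, X p) := (contDiff_jetPolyAdd _ _ _ _ _).contDiffAt
  have hws' : ContDiffAt ℝ ∞ w' (T p, X p) := (contDiff_jetPolyAdd _ _ _ _ _).contDiffAt
  have hw0 : w (T p, X p) = U p := by rw [hw, jetPolyAdd_self, hc0]
  have hw0' : w' (T p, X p) = U p := by simp [hw', jetPolyAdd_self, hc', hc0]
  have hlw : lhs θ' w (T p, X p) = 0 := by rw [lhs_jetPolyAdd, hl]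
  have hlw' : lhs θ' w' (T p, X p) = 0 := by
    rw [lhs_jetPolyAdd]
    have : jetLhs (θ' (T p)) (X p) c' (q + δ)
        = jetLhs (θ' (T p)) (X p) c q + (δ + 120 * θ' (T p) .g * b) := by
      simp [jetLhs, hc']
      ring
    rw [this, hl, hδ, add_zero]
  have hG := contDiffAt_defect hTp hXp hUp hws
  have hG' := contDiffAt_defect hTp hXp hUp hws'
  have hfd := fderiv_defect_jetPolyAdd dT dX dU c q 0
  have hfd' := fderiv_defect_jetPolyAdd dT dX dU c' (q + δ) a
  have hc1 : c' 1 = c 1 := by simp [hc']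
  rw [hc1] at hfd'
  set κ := fderiv ℝ U p (0, 0, 1) - (q * fderiv ℝ T p (0, 0, 1) + c 1 * fderiv ℝ X p (0, 0, 1))
    with hκdef
  have hκ1 : fderiv ℝ (defect T X U w) p (0, 0, 1) = κ := hfd _
  have hκ2 : fderiv ℝ (defect T X U w') p (0, 0, 1) = κ := by
    rw [hfd', add_mul, hδu, add_zero]
  obtain ⟨v, hvs, hvu, hv⟩ := exists_implicit_graph hG (by simp [defect, ← hpdef, hw0])
    (by rw [hκ1]; exact hκ)
  obtain ⟨v', hvs', hvu', hv'⟩ := exists_implicit_graph hG' (by simp [defect, ← hpdef, hw0'])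
    (by rw [hκ2]; exact hκ)
  have hlv : lhs θ v (t, x) = 0 :=
    (h t x u hp v w hvs hvu hws (hv.mono fun r hr => (sub_eq_zero.1 hr).symm)).2 hlw
  have hlv' : lhs θ v' (t, x) = 0 :=
    (h t x u hp v' w' hvs' hvu' hws' (hv'.mono fun r hr => (sub_eq_zero.1 hr).symm)).2 hlw'
  obtain ⟨cv, qv, -, hcv, -, hqv⟩ := exists_lhs_eq_jetLhs hvs
  obtain ⟨cv', qv', -, -, hζ, hqv'⟩ := exists_lhs_eq_jetLhs hvs'
  set ζ := cv' 1 with hζdef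
  let E : ℝ × ℝ → ℝ := fun r => a * (T (r.1, r.2, v' r) - T p) ^ 5
    + b * (X (r.1, r.2, v' r) - X p) ^ 5 + δ * (T (r.1, r.2, v' r) - T p)
  have hE : ∀ᶠ r in 𝓝 (t, x), defect T X U w (r.1, r.2, v' r) = E r := by
    filter_upwards [hv'] with r hr
    simp only [defect, hw, hw', jetPolyAdd, jetPoly, Finset.sum_range_succ, hc', E] at hr ⊢
    simp at hr ⊢
    linarith
  have hTx := hasDerivAt_graph_right dT hvu' hζ
  have hXx := hasDerivAt_graph_right dX hvu' hζ
  have hTt := hasDerivAt_graph_left dT hvu' hqv'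
  have hXt := hasDerivAt_graph_left dX hvu' hqv'
  set A := fderiv ℝ T p (0, 1, 0) + fderiv ℝ T p (0, 0, 1) * ζ with hA
  set B := fderiv ℝ X p (0, 1, 0) + fderiv ℝ X p (0, 0, 1) * ζ with hB
  have hρx : Tendsto (fun y : ℝ => (t, y)) (𝓝 x) (𝓝 (t, x)) :=
    Continuous.tendsto (by fun_prop) x
  have hρt : Tendsto (fun s : ℝ => (s, x)) (𝓝 t) (𝓝 (t, x)) :=
    Continuous.tendsto (f := fun s : ℝ => (s, x)) (by fun_prop) t
  have hEx : (fun y => E (t, y) - (a * A ^ 5 + b * B ^ 5) * (y - x) ^ 5) =o[𝓝 x]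
      fun y => (y - x) ^ 5 := by
    have h1 := (hTx.isLittleO_pow_five.const_mul_left a).add (hXx.isLittleO_pow_five.const_mul_left b)
    refine h1.congr' ?_ EventuallyEq.rfl
    filter_upwards [hρx.eventually (eventually_mem_graph hΩ hp hvs'.continuousAt hvu')] with y hy
    -- On the line `t = const` the linear term must vanish identically, not just to first order,
    -- lest it affect the derivatives of orders two to five.
    have h2 : δ * (T (t, y, v' (t, y)) - T p) = 0 := by
      rcases hδT with h0 | h0
      · rw [h0, zero_mul]
      · rw [h0 _ _ hy, sub_self, mul_zero]
    simp only [E, h2, hvu', ← hpdef]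
    ring
  have hEt : (fun s => E (s, x) - (δ * fderiv ℝ T p (1, 0, 0)) * (s - t) ^ 1) =o[𝓝 t]
      fun s => (s - t) ^ 1 := by
    have h1 : HasDerivAt (fun s => E (s, x)) (δ * fderiv ℝ T p (1, 0, 0)) t := by
      have h2 := ((((hTt.sub_const (T p)).pow 5).const_mul a).add
        (((hXt.sub_const (X p)).pow 5).const_mul b)).add ((hTt.sub_const (T p)).const_mul δ)
      convert! h2 using 1
      simp only [hvu', ← hpdef, sub_self]
      linear_combination (-qv') * hδu
    refine (h1.isLittleO).congr (fun s => ?_) fun s => by simp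
    simp [E, hvu', ← hpdef, mul_comm]
  have hne : fderiv ℝ (defect T X U w) p (0, 0, 1) ≠ 0 := by rw [hκ1]; exact hκ
  have h5 := isLittleO_sub_of_implicit hG hne hvs.continuousAt hvs'.continuousAt hvu hvu' hv hE
    hρx hEx
  have h1 := isLittleO_sub_of_implicit hG hne hvs.continuousAt hvs'.continuousAt hvu hvu' hv hE
    hρt hEt
  rw [← hpdef, hκ1] at h5 h1
  have hexp : HasExpansion (fun y => v' (t, y)) x
      (fun k => cv k + if k = 5 then (a * A ^ 5 + b * B ^ 5) / κ else 0) 5 := by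
    have h6 : HasExpansion (fun y => v' (t, y) - v (t, y)) x
        (fun k => if k = 5 then (a * A ^ 5 + b * B ^ 5) / κ else 0) 5 := by
      refine h5.congr_left fun y => ?_
      simp
    refine (hcv.add h6).congr (Eventually.of_forall fun y => ?_)
    ring
  have hder : HasDerivAt (fun s => v' (s, x)) (qv + δ * fderiv ℝ T p (1, 0, 0) / κ) t := by
    have h6 : HasExpansion (fun s => v' (s, x) - v (s, x)) t
        (fun k => if k = 1 then δ * fderiv ℝ T p (1, 0, 0) / κ else 0) 1 := by
      refine h1.congr_left fun y => ?_
      simp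
    have h7 := hqv.add (h6.hasDerivAt (by simp [hvu, hvu']))
    convert! h7 using 1
    ext s
    simp
  rw [lhs_eq_jetLhs hvs hcv hqv] at hlv
  rw [lhs_eq_jetLhs hvs' hexp hder] at hlv'
  refine ⟨ζ, ?_, ?_⟩
  · have h8 := hasDerivAt_graph_right (hG'.differentiableAt (by simp)) hvu' hζ
    have h9 : (fun y => defect T X U w' (t, y, v' (t, y))) =ᶠ[𝓝 x] fun _ => 0 :=
      hρx.eventually hv'
    have h10 := h8.unique ((hasDerivAt_const x (0 : ℝ)).congr_of_eventuallyEq h9)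
    rw [← hpdef, hκ2, hfd'] at h10
    linear_combination h10 + hδx
  · simp [jetLhs] at hlv hlv'
    have h11 : 120 * θ t .g * ((a * A ^ 5 + b * B ^ 5) / κ) + δ * fderiv ℝ T p (1, 0, 0) / κ = 0 := by
      linarith
    field_simp at h11
    linarith

/-! ### Determining equations for the components `T` and `X` -/

/-- As `g ≠ 0`, the equation can be solved for `u_xxxxx`, so it does not restrict first-order jets.
-/
theorem exists_jetLhs_eq_zero {θ : Values} (hg : θ .g ≠ 0) (x c₀ c₁ q : ℝ) :
    ∃ c : ℕ → ℝ, c 0 = c₀ ∧ c 1 = c₁ ∧ jetLhs θ x c q = 0 := by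
  refine ⟨coeffs c₀ c₁ 0 0 0 (-(jetLhs θ x (coeffs c₀ c₁ 0 0 0 0) q) / (120 * θ .g)), rfl, rfl, ?_⟩
  simp only [jetLhs, coeffs]
  field_simp
  ring

section Determining

variable {Ω : Set Vars} {T X U : Vars → ℝ} {θ θ' : Elements} {t x u : ℝ}

theorem fderiv_components {p : Vars} (hT : DifferentiableAt ℝ T p) (hX : DifferentiableAt ℝ X p)
    (hU : DifferentiableAt ℝ U p) (z : Vars) :
    fderiv ℝ (fun p => (T p, X p, U p)) p z = (fderiv ℝ T p z, fderiv ℝ X p z, fderiv ℝ U p z) := by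
  rw [(hT.hasFDerivAt.prodMk (hX.hasFDerivAt.prodMk hU.hasFDerivAt)).fderiv]
  rfl

theorem apply_vars (L : Vars →L[ℝ] ℝ) (a b c : ℝ) :
    L (a, b, c) = a * L (1, 0, 0) + b * L (0, 1, 0) + c * L (0, 0, 1) := by
  rw [show ((a, b, c) : Vars) = a • (1, 0, 0) + b • (0, 1, 0) + c • (0, 0, 1) by simp,
    map_add, map_add, map_smul, map_smul, map_smul]
  rfl

/-- The perturbation `a = 1`, `b = δ = 0` yields `D_x T = 0` on every first-order jet transversal at
the point. Eliminating `ζ` turns this into a relation linear in `c₁`, whose coefficients are minors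
of the Jacobian. -/
theorem MapsEquation.fderiv_time_eq_zero (hΩ : IsOpen Ω)
    (hT : ContDiffOn ℝ ∞ T Ω) (hX : ContDiffOn ℝ ∞ X Ω) (hU : ContDiffOn ℝ ∞ U Ω)
    (h : MapsEquation Ω (fun p => (T p, X p, U p)) θ θ') (hp : (t, x, u) ∈ Ω)
    (hdet : (fderiv ℝ (fun p => (T p, X p, U p)) (t, x, u)).det ≠ 0)
    (hg : θ t .g ≠ 0) (hg' : θ' (T (t, x, u)) .g ≠ 0) :
    fderiv ℝ T (t, x, u) (0, 1, 0) = 0 ∧ fderiv ℝ T (t, x, u) (0, 0, 1) = 0 := by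
  have dT := (hT.contDiffAt (hΩ.mem_nhds hp)).differentiableAt (by simp)
  have dX := (hX.contDiffAt (hΩ.mem_nhds hp)).differentiableAt (by simp)
  have dU := (hU.contDiffAt (hΩ.mem_nhds hp)).differentiableAt (by simp)
  rw [det_ne_zero_iff_injective, injective_iff_map_eq_zero] at hdet
  have hinj : ∀ b c : ℝ, fderiv ℝ T (t, x, u) (0, b, c) = 0 → fderiv ℝ X (t, x, u) (0, b, c) = 0 →
      fderiv ℝ U (t, x, u) (0, b, c) = 0 → b = 0 ∧ c = 0 := by
    intro b c h1 h2 h3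
    have := hdet (0, b, c) (by rw [fderiv_components dT dX dU, h1, h2, h3]; rfl)
    simpa using this
  have key : ∀ q c₁ : ℝ, fderiv ℝ U (t, x, u) (0, 0, 1) - (q * fderiv ℝ T (t, x, u) (0, 0, 1)
      + c₁ * fderiv ℝ X (t, x, u) (0, 0, 1)) ≠ 0 →
      (fderiv ℝ T (t, x, u) (0, 1, 0) * fderiv ℝ U (t, x, u) (0, 0, 1)
        - fderiv ℝ T (t, x, u) (0, 0, 1) * fderiv ℝ U (t, x, u) (0, 1, 0))
      - c₁ * (fderiv ℝ T (t, x, u) (0, 1, 0) * fderiv ℝ X (t, x, u) (0, 0, 1)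
        - fderiv ℝ T (t, x, u) (0, 0, 1) * fderiv ℝ X (t, x, u) (0, 1, 0)) = 0 := by
    intro q c₁ hκ
    obtain ⟨c, hc0, rfl, hl⟩ := exists_jetLhs_eq_zero hg' (X (t, x, u)) (U (t, x, u)) c₁ q
    obtain ⟨ζ, h1, h2⟩ := h.perturbation hΩ hT hX hU hp (a := 1) (b := 0) (δ := 0) hc0 hl
      (by ring) (by ring) (by ring) (Or.inl rfl) hκ
    have h3 : fderiv ℝ T (t, x, u) (0, 1, 0) + fderiv ℝ T (t, x, u) (0, 0, 1) * ζ = 0 := by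
      by_contra h4
      have := mul_ne_zero (mul_ne_zero (by norm_num : (120 : ℝ) ≠ 0) hg) (pow_ne_zero 5 h4)
      exact this (by linarith)
    linear_combination (fderiv ℝ U (t, x, u) (0, 0, 1) - (q * fderiv ℝ T (t, x, u) (0, 0, 1)
      + c 1 * fderiv ℝ X (t, x, u) (0, 0, 1))) * h3 - fderiv ℝ T (t, x, u) (0, 0, 1) * h1
  have hx := apply_vars (fderiv ℝ X (t, x, u))
  have hu := apply_vars (fderiv ℝ U (t, x, u))
  have ht := apply_vars (fderiv ℝ T (t, x, u))
  have hz := hinj 0 1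
  generalize fderiv ℝ T (t, x, u) (0, 1, 0) = Tx at *
  generalize fderiv ℝ T (t, x, u) (0, 0, 1) = Tu at *
  generalize fderiv ℝ X (t, x, u) (0, 1, 0) = Xx at *
  generalize fderiv ℝ X (t, x, u) (0, 0, 1) = Xu at *
  generalize fderiv ℝ U (t, x, u) (0, 1, 0) = Ux at *
  generalize fderiv ℝ U (t, x, u) (0, 0, 1) = Uu at *
  -- Multiplication by the transversality factor makes the relation hold for all `q` and `c₁`, so a
  -- polynomial vanishes identically and its coefficients can be read off from five values.
  have key' : ∀ q c₁ : ℝ, ((Tx * Uu - Tu * Ux) - c₁ * (Tx * Xu - Tu * Xx))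
      * (Uu - (q * Tu + c₁ * Xu)) = 0 := by
    intro q c₁
    by_cases h0 : Uu - (q * Tu + c₁ * Xu) = 0
    · rw [h0, mul_zero]
    · rw [key q c₁ h0, zero_mul]
  generalize hA : Tx * Uu - Tu * Ux = A at key'
  generalize hB : Tx * Xu - Tu * Xx = B at key'
  have k00 := key' 0 0
  have k10 := key' 1 0
  have k01 := key' 0 1
  have k11 := key' 1 1
  have k0n := key' 0 (-1)
  have hAT : A * Tu = 0 := by linarith
  have hBT : B * Tu = 0 := by linarith
  have hAU : A * Uu = 0 := by linarith
  have hBX : B * Xu = 0 := by linarith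
  have hAB : A * Xu + B * Uu = 0 := by linarith
  have hAX : A * Xu = 0 := by
    have : (A * Xu) ^ 2 = 0 := by linear_combination A * Xu * hAB - B * Xu * hAU
    exact pow_eq_zero_iff (two_ne_zero) |>.1 this
  have hBU : B * Uu = 0 := by linarith
  have hA0 : A = 0 := by
    by_contra hA'
    exact one_ne_zero (hz ((mul_eq_zero.1 hAT).resolve_left hA') ((mul_eq_zero.1 hAX).resolve_left hA')
      ((mul_eq_zero.1 hAU).resolve_left hA')).2
  have hB0 : B = 0 := by
    by_contra hB'
    exact one_ne_zero (hz ((mul_eq_zero.1 hBT).resolve_left hB') ((mul_eq_zero.1 hBX).resolve_left hB')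
      ((mul_eq_zero.1 hBU).resolve_left hB')).2
  -- With both minors zero, the direction `(0, T_u, -T_x)` lies in the kernel of the Jacobian.
  have := hinj Tu (-Tx) (by rw [ht]; ring) (by rw [hx]; linarith) (by rw [hu]; linarith)
  exact ⟨by linarith [this.2], this.1⟩

/-- The perturbation `b = 1`, `δ = -120 g'` yields `g (D_x X)^5 = g' T_t`. Multiplied by the fifth
power of the transversality factor, the left side no longer depends on `c₁`, while the right side
does unless `X_u = 0`. -/
theorem MapsEquation.fderiv_space (hΩ : IsOpen Ω)
    (hT : ContDiffOn ℝ ∞ T Ω) (hX : ContDiffOn ℝ ∞ X Ω) (hU : ContDiffOn ℝ ∞ U Ω)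
    (h : MapsEquation Ω (fun p => (T p, X p, U p)) θ θ') (hp : (t, x, u) ∈ Ω)
    (hdet : (fderiv ℝ (fun p => (T p, X p, U p)) (t, x, u)).det ≠ 0)
    (hg : θ t .g ≠ 0) (hg' : θ' (T (t, x, u)) .g ≠ 0)
    (hTx : fderiv ℝ T (t, x, u) (0, 1, 0) = 0) (hTu : fderiv ℝ T (t, x, u) (0, 0, 1) = 0)
    (hTt : ∀ y z, (t, y, z) ∈ Ω → T (t, y, z) = T (t, x, u)) :
    fderiv ℝ X (t, x, u) (0, 0, 1) = 0 ∧ fderiv ℝ X (t, x, u) (0, 1, 0) ≠ 0 ∧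
      fderiv ℝ U (t, x, u) (0, 0, 1) ≠ 0 ∧
      θ t .g * fderiv ℝ X (t, x, u) (0, 1, 0) ^ 5
        = θ' (T (t, x, u)) .g * fderiv ℝ T (t, x, u) (1, 0, 0) := by
  have dT := (hT.contDiffAt (hΩ.mem_nhds hp)).differentiableAt (by simp)
  have dX := (hX.contDiffAt (hΩ.mem_nhds hp)).differentiableAt (by simp)
  have dU := (hU.contDiffAt (hΩ.mem_nhds hp)).differentiableAt (by simp)
  rw [det_ne_zero_iff_injective, injective_iff_map_eq_zero] at hdet
  have hinj : ∀ b c : ℝ, fderiv ℝ X (t, x, u) (0, b, c) = 0 →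
      fderiv ℝ U (t, x, u) (0, b, c) = 0 → b = 0 ∧ c = 0 := by
    intro b c h2 h3
    have h1 : fderiv ℝ T (t, x, u) (0, b, c) = 0 := by rw [apply_vars, hTx, hTu]; ring
    have := hdet (0, b, c) (by rw [fderiv_components dT dX dU, h1, h2, h3]; rfl)
    simpa using this
  have key : ∀ c₁ : ℝ, fderiv ℝ U (t, x, u) (0, 0, 1) - c₁ * fderiv ℝ X (t, x, u) (0, 0, 1) ≠ 0 →
      θ t .g * (fderiv ℝ X (t, x, u) (0, 1, 0) * fderiv ℝ U (t, x, u) (0, 0, 1)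
        - fderiv ℝ X (t, x, u) (0, 0, 1) * fderiv ℝ U (t, x, u) (0, 1, 0)) ^ 5
      = θ' (T (t, x, u)) .g * fderiv ℝ T (t, x, u) (1, 0, 0)
        * (fderiv ℝ U (t, x, u) (0, 0, 1) - c₁ * fderiv ℝ X (t, x, u) (0, 0, 1)) ^ 5 := by
    intro c₁ hκ
    obtain ⟨c, hc0, rfl, hl⟩ := exists_jetLhs_eq_zero hg' (X (t, x, u)) (U (t, x, u)) c₁ 0
    obtain ⟨ζ, h1, h2⟩ := h.perturbation hΩ hT hX hU hp (a := 0) (b := 1)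
      (δ := -(120 * θ' (T (t, x, u)) .g)) hc0 hl (by ring) (by rw [hTx, mul_zero])
      (by rw [hTu, mul_zero]) (Or.inr hTt) (by simpa using hκ)
    simp only [zero_mul, zero_add] at h1 h2
    have h3 : (fderiv ℝ U (t, x, u) (0, 0, 1) - c 1 * fderiv ℝ X (t, x, u) (0, 0, 1))
        * (fderiv ℝ X (t, x, u) (0, 1, 0) + fderiv ℝ X (t, x, u) (0, 0, 1) * ζ)
        = fderiv ℝ X (t, x, u) (0, 1, 0) * fderiv ℝ U (t, x, u) (0, 0, 1)
        - fderiv ℝ X (t, x, u) (0, 0, 1) * fderiv ℝ U (t, x, u) (0, 1, 0) := by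
      linear_combination fderiv ℝ X (t, x, u) (0, 0, 1) * h1
    rw [← h3, mul_pow]
    linear_combination (fderiv ℝ U (t, x, u) (0, 0, 1)
      - c 1 * fderiv ℝ X (t, x, u) (0, 0, 1)) ^ 5 / 120 * h2
  have hx := apply_vars (fderiv ℝ X (t, x, u))
  have hu := apply_vars (fderiv ℝ U (t, x, u))
  have hz := hinj 0 1
  have hy := hinj 1 0
  generalize fderiv ℝ X (t, x, u) (0, 1, 0) = Xx at *
  generalize fderiv ℝ X (t, x, u) (0, 0, 1) = Xu at *
  generalize fderiv ℝ U (t, x, u) (0, 1, 0) = Ux at *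
  generalize fderiv ℝ U (t, x, u) (0, 0, 1) = Uu at *
  have hC : Xx * Uu - Xu * Ux ≠ 0 := by
    intro h0
    have h1 := hinj Xu (-Xx) (by rw [hx]; ring) (by rw [hu]; linarith)
    have h2 := hinj Uu (-Ux) (by rw [hx]; linarith) (by rw [hu]; ring)
    exact one_ne_zero (hz h1.1 h2.1).2
  have hXu : Xu = 0 := by
    by_contra hne
    -- These values of `c₁` make the transversality factor equal to `1` and `2`.
    have e1 : Uu - (Uu - 1) / Xu * Xu = 1 := by field_simp; ring
    have e2 : Uu - (Uu - 2) / Xu * Xu = 2 := by field_simp; ring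
    have k1 := key ((Uu - 1) / Xu) (by rw [e1]; norm_num)
    have k2 := key ((Uu - 2) / Xu) (by rw [e2]; norm_num)
    rw [e1] at k1
    rw [e2] at k2
    exact mul_ne_zero hg (pow_ne_zero 5 hC) (by linarith)
  subst hXu
  have hX0 : Xx ≠ 0 := fun h0 => hC (by rw [h0]; ring)
  have hU0 : Uu ≠ 0 := fun h0 => hC (by rw [h0]; ring)
  refine ⟨rfl, hX0, hU0, ?_⟩
  have k := key 0 (by simpa using hU0)
  refine mul_right_cancel₀ (pow_ne_zero 5 hU0) ?_
  linear_combination k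

end Determining

/-! ### Form of admissible transformations, the equivalence group and normalization -/

theorem IsAdmissible.exists_groupParameter {Ω : Set Vars} (hΩ : IsVarDomain Ω) {θ θ' : Elements}
    {Φ : Vars → Vars} (h : IsAdmissible subclassValues Ω θ θ' Φ) :
    ∃ α β γ φ : ℝ → ℝ, IsGroupParameter (times Ω) α β γ φ ∧
      ∀ t x u : ℝ, (t, x, u) ∈ Ω → Φ (t, x, u) = (α t, β t * x + γ t, φ t * u) := by
  set T : Vars → ℝ := fun p => (Φ p).1 with hTdef
  set X : Vars → ℝ := fun p => (Φ p).2.1 with hXdef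
  set U : Vars → ℝ := fun p => (Φ p).2.2 with hUdef
  have hT : ContDiffOn ℝ ∞ T Ω := h.point.smooth.fst
  have hX : ContDiffOn ℝ ∞ X Ω := h.point.smooth.snd.fst
  have hU : ContDiffOn ℝ ∞ U Ω := h.point.smooth.snd.snd
  have hmaps : MapsEquation Ω (fun p => (T p, X p, U p)) θ θ' := h.maps
  have hdet : ∀ p ∈ Ω, (fderiv ℝ (fun p => (T p, X p, U p)) p).det ≠ 0 := h.point.nondegenerate
  have hg : ∀ p ∈ Ω, θ p.1 .g ≠ 0 := fun p hp =>
    (mem_subclassValues_iff.1 (h.source.2 p.1 ⟨p, hp, rfl⟩)).1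
  have hθ' : ∀ p ∈ Ω, θ' (T p) ∈ subclassValues := fun p hp => h.target.2 _ ⟨_, ⟨p, hp, rfl⟩, rfl⟩
  have hg' : ∀ p ∈ Ω, θ' (T p) .g ≠ 0 := fun p hp => (mem_subclassValues_iff.1 (hθ' p hp)).1
  have dT : ∀ p ∈ Ω, DifferentiableAt ℝ T p := fun p hp =>
    (hT.contDiffAt (hΩ.isOpen.mem_nhds hp)).differentiableAt (by simp)
  have dX : ∀ p ∈ Ω, DifferentiableAt ℝ X p := fun p hp =>
    (hX.contDiffAt (hΩ.isOpen.mem_nhds hp)).differentiableAt (by simp)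
  have hT0 : ∀ p ∈ Ω, fderiv ℝ T p (0, 1, 0) = 0 ∧ fderiv ℝ T p (0, 0, 1) = 0 := fun p hp =>
    hmaps.fderiv_time_eq_zero hΩ.isOpen hT hX hU hp (hdet p hp) (hg p hp) (hg' p hp)
  obtain ⟨α, hα⟩ := hΩ.exists_eq_of_section_deriv (F := T) fun p hp =>
    hasFDerivAt_section_zero (dT p hp) (hT0 p hp).1 (hT0 p hp).2
  have sα : ContDiffOn ℝ ∞ α (times Ω) := contDiffOn_of_eq_comp_fst hΩ.isOpen hT hα
  have hI := isOpen_times hΩ.isOpen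
  have hα' : ∀ p ∈ Ω, fderiv ℝ T p (1, 0, 0) = deriv α p.1 := by
    intro p hp
    have h1 : HasFDerivAt (fun p : Vars => α p.1)
        (deriv α p.1 • ContinuousLinearMap.fst ℝ ℝ (ℝ × ℝ)) p :=
      (((sα.contDiffAt (hI.mem_nhds ⟨p, hp, rfl⟩)).differentiableAt
        (by simp)).hasDerivAt).comp_hasFDerivAt p hasFDerivAt_fst
    have h2 : T =ᶠ[𝓝 p] fun p => α p.1 := by
      filter_upwards [hΩ.isOpen.mem_nhds hp] with r hr using hα r hr
    rw [(h1.congr_of_eventuallyEq h2).fderiv]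
    simp
  have hspace : ∀ p ∈ Ω, fderiv ℝ X p (0, 0, 1) = 0 ∧ fderiv ℝ X p (0, 1, 0) ≠ 0 ∧
      fderiv ℝ U p (0, 0, 1) ≠ 0 ∧
      θ p.1 .g * fderiv ℝ X p (0, 1, 0) ^ 5 = θ' (α p.1) .g * deriv α p.1 := by
    intro p hp
    have := hmaps.fderiv_space hΩ.isOpen hT hX hU hp (hdet p hp) (hg p hp) (hg' p hp)
      (hT0 p hp).1 (hT0 p hp).2 fun y z hyz => (hα _ hyz).trans (hα p hp).symm
    rwa [hα p hp, hα' p hp] at this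
  obtain ⟨β, hβ⟩ : ∃ β : ℝ → ℝ, ∀ p ∈ Ω, fderiv ℝ X p (0, 1, 0) = β p.1 := by
    have h1 : ∀ t, ∃ b, ∀ q : ℝ × ℝ, (t, q) ∈ Ω → fderiv ℝ X (t, q) (0, 1, 0) = b := by
      intro t
      by_cases hne : ∃ q : ℝ × ℝ, (t, q) ∈ Ω
      · obtain ⟨q₀, hq₀⟩ := hne
        refine ⟨fderiv ℝ X (t, q₀) (0, 1, 0), fun q hq => ?_⟩
        -- `g X_x^5 = g' α_t` fixes `X_x^5`, hence `X_x`, in terms of `t`.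
        have h5 : Odd 5 := by decide
        refine h5.strictMono_pow.injective (mul_left_cancel₀ (hg _ hq) ?_)
        exact (hspace _ hq).2.2.2.trans (hspace _ hq₀).2.2.2.symm
      · exact ⟨0, fun q hq => absurd ⟨q, hq⟩ hne⟩
    choose β hβ using h1
    exact ⟨β, fun p hp => hβ p.1 p.2 hp⟩
  have sβ : ContDiffOn ℝ ∞ β (times Ω) :=
    contDiffOn_of_eq_comp_fst hΩ.isOpen (contDiffOn_fderiv_apply hΩ.isOpen hX (0, 1, 0)) hβ
  obtain ⟨γ, hγ⟩ := hΩ.exists_eq_of_section_deriv (F := fun p => X p - β p.1 * p.2.1) fun p hp => by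
    have h1 := (hasFDerivAt_section (dX p hp)).sub
      ((hasFDerivAt_fst (𝕜 := ℝ) (p := p.2)).const_mul (β p.1))
    convert! h1 using 1
    ext <;> simp [hβ p hp, (hspace p hp).1]
  have sγ : ContDiffOn ℝ ∞ γ (times Ω) := by
    refine contDiffOn_of_eq_comp_fst hΩ.isOpen
      (F := fun p => X p - fderiv ℝ X p (0, 1, 0) * p.2.1) ?_ fun p hp => ?_
    · exact hX.sub ((contDiffOn_fderiv_apply hΩ.isOpen hX (0, 1, 0)).mul (by fun_prop))
    · rw [hβ p hp, hγ p hp]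
  have hne : ∀ t ∈ times Ω, deriv α t * β t ≠ 0 := by
    rintro _ ⟨p, hp, rfl⟩
    obtain ⟨-, h1, -, h2⟩ := hspace p hp
    rw [hβ p hp] at h1 h2
    refine mul_ne_zero (fun h0 => ?_) h1
    rw [h0, mul_zero] at h2
    exact mul_ne_zero (hg p hp) (pow_ne_zero 5 h1) h2
  -- The factor `φ` is provisionally `1`, so that stripping `α`, `β`, `γ` leaves `U` itself as the
  -- fibre map.
  have hpar : IsGroupParameter (times Ω) α β γ (fun _ => 1) :=
    ⟨hI, hΩ.isPreconnected_times, sα, sβ, sγ, contDiffOn_const,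
      fun t ht => by rw [mul_one]; exact hne t ht⟩
  have hform : ∀ t x u : ℝ, (t, x, u) ∈ Ω →
      Φ (t, x, u) = (α t, β t * x + γ t, (fun _ => (1 : ℝ)) t * U (t, x, u)) := by
    intro t x u hp
    have h1 := hα _ hp
    have h2 := hγ _ hp
    simp only [hTdef, hXdef] at h1 h2
    ext
    · exact h1
    · simp only
      linarith
    · simp [hUdef]
  set θ'' : Elements := fun s => oldValues α β γ (fun _ => 1) s (θ' (α s)) with hθ''
  have hfib : MapsByFiber Ω U θ θ'' := fun t x u hp v hv hu =>
    h.maps.reduce hΩ.isOpen hpar hU hform hp hv hu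
  have hmem : ∀ p ∈ Ω, θ'' p.1 ∈ subclassValues := fun p hp =>
    oldValues_mem_subclassValues (hpar.ne_zero p.1 ⟨p, hp, rfl⟩) (by rw [← hα p hp]; exact hθ' p hp)
  have sκ := contDiffOn_fderiv_apply hΩ.isOpen hU (0, 0, 1)
  obtain ⟨φ, hφ⟩ := hΩ.exists_eq_of_section_deriv (F := fun p => fderiv ℝ U p (0, 0, 1))
    fun p hp => by
      have h1 := hfib.fderiv_fderiv_eq_zero hΩ.isOpen hU (t := p.1) (x := p.2.1) (u := p.2.2) hp
        (mem_subclassValues_iff.1 (hmem p hp)).1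
      have h2 := h1 0
      have h3 := h1 1
      rw [apply_vars] at h3
      refine hasFDerivAt_section_zero
        ((sκ.contDiffAt (hΩ.isOpen.mem_nhds hp)).differentiableAt (by simp)) h2 ?_
      rw [h2] at h3
      simpa using h3
  have hφ0 : ∀ p ∈ Ω, φ p.1 ≠ 0 := fun p hp => by
    rw [← hφ p hp]
    exact (hspace p hp).2.2.1
  refine ⟨α, β, γ, φ, ⟨hI, hΩ.isPreconnected_times, sα, sβ, sγ,
    contDiffOn_of_eq_comp_fst hΩ.isOpen sκ hφ, ?_⟩, ?_⟩
  · rintro _ ⟨p, hp, rfl⟩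
    exact mul_ne_zero (hne _ ⟨p, hp, rfl⟩) (hφ0 p hp)
  · intro t x u hp
    rw [hform t x u hp, hfib.eq_mul hΩ.isOpen hU hφ hp (h.source.2 t (mem_times hp)) (hmem _ hp)
      (hφ0 _ hp), one_mul]

theorem MapsEquation.target_eq_newValues {Ω : Set Vars} (hΩ : IsOpen Ω) {Φ : Vars → Vars}
    {α β γ φ : ℝ → ℝ} (hg : IsGroupParameter (times Ω) α β γ φ)
    (hΦ : ∀ t x u : ℝ, (t, x, u) ∈ Ω → Φ (t, x, u) = (α t, β t * x + γ t, φ t * u))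
    {θ θ' : Elements} (h : MapsEquation Ω Φ θ θ') {t : ℝ} (ht : t ∈ times Ω)
    (hθ : θ t ∈ subclassValues) (hθ' : θ' (α t) ∈ subclassValues) :
    θ' (α t) = newValues α β γ φ t (θ t) := by
  have := elements_eq_of_lhs_iff hΩ (θ' := fun s => oldValues α β γ φ s (θ' (α s))) ht hθ
    (oldValues_mem_subclassValues (hg.ne_zero t ht) hθ') fun x u hp v hv hu =>
      h.reduce hΩ hg (V := fun p => p.2.2) (by fun_prop) hΦ hp hv hu
  rw [this, newValues_oldValues (hg.ne_zero t ht)]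

/-- Constant tuples realize every value in the subclass. One of them makes `Φ` admissible and fixes
its form; each of the others then determines `Θ` at its value by uniqueness of the target tuple. -/
theorem IsUsualEquivalence.hasGroupForm {Ω : Set Vars} (hΩ : IsVarDomain Ω) {Φ : Vars → Vars}
    {Θ : Vars → Values → Values} (h : IsUsualEquivalence subclassValues Ω Φ Θ) :
    HasGroupForm subclassValues Ω Φ Θ := by
  have hconst : ∀ v ∈ subclassValues, (fun _ => v) ∈ elementsOn subclassValues (times Ω) :=
    fun v hv => ⟨contDiffOn_const, fun _ _ => hv⟩
  have hv₀ : (fun i => if i = .a ∨ i = .g then 1 else 0 : Values) ∈ subclassValues := by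
    rw [mem_subclassValues_iff]
    simp
  obtain ⟨θ₀', hθ₀', -, hmaps₀⟩ := h.preserves _ (hconst _ hv₀)
  obtain ⟨α, β, γ, φ, hg, hΦ⟩ :=
    IsAdmissible.exists_groupParameter hΩ ⟨h.point, hconst _ hv₀, hθ₀', hmaps₀⟩
  refine ⟨α, β, γ, φ, hg.smooth_α, hg.smooth_β, hg.smooth_γ, hg.smooth_φ, hg.ne_zero,
    fun t x u hp => ⟨hΦ t x u hp, fun v hv => ?_⟩⟩
  obtain ⟨θ', hθ', htakes, hmaps⟩ := h.preserves _ (hconst v hv)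
  have h1 := htakes _ hp
  have h2 : (Φ (t, x, u)).1 ∈ times (Φ '' Ω) := ⟨_, ⟨_, hp, rfl⟩, rfl⟩
  rw [hΦ t x u hp] at h1 h2
  rw [← h1]
  exact hmaps.target_eq_newValues hΩ.isOpen hg hΦ (mem_times hp) hv (hθ'.2 _ h2)

theorem isNormalizedUsual_subclassValues : IsNormalizedUsual subclassValues := by
  intro Ω hΩ θ θ' Φ h
  obtain ⟨α, β, γ, φ, hg, hΦ⟩ := h.exists_groupParameter hΩ
  refine ⟨fun p v => newValues α β γ φ p.1 v, HasGroupForm.isUsualEquivalence hΩ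
    ⟨α, β, γ, φ, hg.smooth_α, hg.smooth_β, hg.smooth_γ, hg.smooth_φ, hg.ne_zero,
      fun t x u hp => ⟨hΦ t x u hp, fun _ _ => rfl⟩⟩, ?_⟩
  rintro ⟨t, x, u⟩ hp
  have h2 : (Φ (t, x, u)).1 ∈ times (Φ '' Ω) := ⟨_, ⟨_, hp, rfl⟩, rfl⟩
  rw [hΦ t x u hp] at h2 ⊢
  exact h.maps.target_eq_newValues hΩ.isOpen hg hΦ (mem_times hp)
    (h.source.2 _ (mem_times hp)) (h.target.2 _ h2)

theorem corollary1 :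
    (∀ Ω : Set Vars, IsVarDomain Ω →
      ∀ (Φ : Vars → Vars) (Θ : Vars → Values → Values),
        IsUsualEquivalence subclassValues Ω Φ Θ ↔ HasGroupForm subclassValues Ω Φ Θ) ∧
    IsNormalizedUsual subclassValues :=
  ⟨fun _ hΩ _ _ => ⟨fun h => h.hasGroupForm hΩ, fun h => h.isUsualEquivalence hΩ⟩,
    isNormalizedUsual_subclassValues⟩
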